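/- Let $n\ge 3$, let $A=\mathbb C[x_1,\dots,x_n]$ and $B=\mathbb C(x_1,\dots,x_n)$, and let $s_1,t_1,\dots,s_{n-2},t_{n-2}\in A$ be such that, for each $i$, $t_i\ne 0$ and $s_i,t_i$ have no non-unit common factor, and such that $s_1/t_1,\dots,s_{n-2}/t_{n-2}$ are algebraically independent over $\mathbb C$. Equip $A$ with the Poisson bracket $$\{f,g\}=(t_1\cdots t_{n-2})^2\,\mathrm{Jac}(f,g,s_1/t_1,\dots,s_{n-2}/t_{n-2}),$$ where $\mathrm{Jac}$ is the Jacobian determinant in $B$; this bracket maps $A\times A$ to $A$. Terminology. An ideal $I$ of $A$ is Poisson if $\{i,r\}\in I$ for all $i\in I$, $r\in A$; a Poisson ideal $I$ is residually null if $\{a,b\}\in I$ for all $a,b\in A$. A Poisson maximal ideal is a maximal ideal of $A$ that is a Poisson ideal. A Poisson ideal is Poisson primitive if it is the largest Poisson ideal contained in some maximal ideal of $A$. A Poisson ideal $P\neq A$ is Poisson prime if, for all Poisson ideals $I,J$, $IJ\subseteq P$ implies $I\subseteq P$ or $J\subseteq P$. A Poisson prime ideal $P$ is locally closed if $\{P\}$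 is locally closed in the set of Poisson prime ideals with the Zariski topology, and rational if the only elements of the quotient field $Q(A/P)$ that have zero bracket with every element (for the bracket induced on $A/P$ and extended to $Q(A/P)$ by the quotient rule) are those of $\mathbb C$. Theorem. (1) An ideal $P$ of $A$ is Poisson primitive if and only if either $P$ is a Poisson maximal ideal, or $P$ is a Poisson ideal that is not residually null and there are $(\lambda_i,\mu_i)\in\mathbb C^2\setminus\{(0,0)\}$, $1\le i\le n-2$, such that the ideal $I$ of $A$ generated by the elements $\lambda_i s_i-\mu_i t_i$ is not equal to $A$ and $P$ is a minimal prime ideal over $I$. (2) The Poisson maximal ideals of $A$ are the ideals $M_p=(x_1-p_1,\dots,x_n-p_n)$ with $p\in\mathbb C^n$ such that, with $g_i=t_i(p)s_i-s_i(p)t_i$, at least one of the following holds: $s_i(p)=t_i(p)=0$ for some $i$; or $g_1,\dots,g_{n-2}$ are algebraically dependent over $\mathbb C$; or $p$ is a common zero of $g_1,\dots,g_{n-2}$ at which the Jacobian matrix $(\partial g_i/\partial x_j(p))$ has rank less than $n-2$. (3) $A$ satisfies the Poisson Dixmier–Moeglin equivalence: for a Poisson prime ideal $P$ of $A$, the conditions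 that $P$ is locally closed, that $P$ is Poisson primitive, and that $P$ is rational are equivalent. -/

import Mathlib

open scoped nonZeroDivisors

namespace JacobianPoisson

/-! ### Brackets on commutative algebras -/

section General

variable {R : Type*} [CommRing R]

/-- The biadditivity and Leibniz rules of a Poisson bracket; they are what makes the induced
brackets on quotients and on fraction fields well defined. -/
structure IsBiderivation (br : R → R → R) : Prop where
  add_left : ∀ a b c, br (a + b) c = br a c + br b c
  add_right : ∀ a b c, br a (b + c) = br a b + br a c
  leibniz_left : ∀ a b c, br (a * b) c = a * br b c + b * br a c
  leibniz_right : ∀ a b c, br a (b * c) = b * br a c + c * br a b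

/-- An ideal `I` is Poisson if `{i, r} ∈ I` for all `i ∈ I` and all `r`. -/
def IsPoissonIdeal (br : R → R → R) (I : Ideal R) : Prop :=
  ∀ i ∈ I, ∀ r : R, br i r ∈ I

/-- `I` contains all brackets, i.e. the induced bracket on `R ⧸ I` is zero. -/
def IsResiduallyNull (br : R → R → R) (I : Ideal R) : Prop :=
  ∀ a b : R, br a b ∈ I

/-- Poisson prime ideals: primeness is tested on Poisson ideals only. -/
structure IsPoissonPrime (br : R → R → R) (P : Ideal R) : Prop where
  isPoisson : IsPoissonIdeal br P
  ne_top : P ≠ ⊤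
  le_or_le : ∀ I J : Ideal R, IsPoissonIdeal br I → IsPoissonIdeal br J →
    I * J ≤ P → I ≤ P ∨ J ≤ P

/-- A maximal ideal that is also a Poisson ideal. -/
def IsPoissonMaximal (br : R → R → R) (M : Ideal R) : Prop :=
  M.IsMaximal ∧ IsPoissonIdeal br M

/-- The Poisson core of `I`: the largest Poisson ideal contained in `I`. -/
def poissonCore (br : R → R → R) (I : Ideal R) : Ideal R :=
  sSup {J : Ideal R | IsPoissonIdeal br J ∧ J ≤ I}

theorem poissonCore_isGreatest {br : R → R → R} (h : IsBiderivation br) (I : Ideal R) :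
    IsGreatest {J : Ideal R | IsPoissonIdeal br J ∧ J ≤ I} (poissonCore br I) := by
  have h0 : ∀ r, br 0 r = 0 := fun r => by simpa using h.add_left 0 0 r
  refine ⟨⟨?_, sSup_le fun J hJ => hJ.2⟩, fun J hJ => le_sSup hJ⟩
  intro i hi r
  rw [poissonCore, sSup_eq_iSup'] at hi ⊢
  refine Submodule.iSup_induction _ (motive := fun i => br i r ∈ _) hi ?_ ?_ ?_
  · intro J x hx
    exact (le_iSup (fun J : {J : Ideal R | IsPoissonIdeal br J ∧ J ≤ I} => (J : Ideal R)) J)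
      (J.2.1 x hx r)
  · rw [h0]; exact Submodule.zero_mem _
  · intro x y hx hy
    rw [h.add_left]
    exact Submodule.add_mem _ hx hy

/-- A Poisson ideal that is the Poisson core of some maximal ideal. -/
def IsPoissonPrimitive (br : R → R → R) (P : Ideal R) : Prop :=
  IsPoissonIdeal br P ∧ ∃ M : Ideal R, M.IsMaximal ∧ P = poissonCore br M

/-- The set of Poisson prime ideals. -/
def PoissonSpectrum (br : R → R → R) : Type _ := {P : Ideal R // IsPoissonPrime br P}

/-- The Zariski topology: the sets `{P | I ≤ P}`, for `I` an ideal, are (sub)basic closed sets. -/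
instance (br : R → R → R) : TopologicalSpace (PoissonSpectrum br) :=
  TopologicalSpace.generateFrom {U | ∃ I : Ideal R, U = {P | I ≤ P.1}ᶜ}

/-- The induced bracket on `R ⧸ I`: `{a + I, b + I} = {a, b} + I`. -/
noncomputable def quotientBracket (br : R → R → R) (I : Ideal R) (x y : R ⧸ I) : R ⧸ I :=
  Ideal.Quotient.mk I (br (Quotient.out x) (Quotient.out y))

/-- The numerator of `{a/s, b/t}`, over the denominator `s² t²`, in the quotient rule. -/
def quotientRuleNum (br : R → R → R) (a s b t : R) : R :=
  br a b * s * t - br a t * s * b - br s b * a * t + br s t * a * b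

/-- The extension of a bracket to the ring of fractions by the quotient rule. -/
noncomputable def fractionBracket (br : R → R → R) (z w : FractionRing R) : FractionRing R :=
  IsLocalization.mk' (FractionRing R)
    (quotientRuleNum br (IsLocalization.sec R⁰ z).1 (IsLocalization.sec R⁰ z).2
      (IsLocalization.sec R⁰ w).1 (IsLocalization.sec R⁰ w).2)
    ((IsLocalization.sec R⁰ z).2 ^ 2 * (IsLocalization.sec R⁰ w).2 ^ 2)

/-- The elements whose bracket with every element is zero. -/
def poissonCenter (br : R → R → R) : Set R := {z | ∀ w, br z w = 0}

/-- The quotient bracket does not depend on representatives. -/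
theorem quotientBracket_mk {br : R → R → R} (h : IsBiderivation br)
    (anti : ∀ a b, br a b = - br b a) {I : Ideal R} (hI : IsPoissonIdeal br I) (a b : R) :
    quotientBracket br I (Ideal.Quotient.mk I a) (Ideal.Quotient.mk I b)
      = Ideal.Quotient.mk I (br a b) := by
  have key : ∀ x : R, ∃ i ∈ I, Quotient.out (Ideal.Quotient.mk I x) = x + i := by
    intro x
    refine ⟨Quotient.out (Ideal.Quotient.mk I x) - x, ?_, by ring⟩
    rw [← Ideal.Quotient.eq]
    exact Quotient.out_eq _
  obtain ⟨i, hi, hi'⟩ := key a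
  obtain ⟨j, hj, hj'⟩ := key b
  rw [quotientBracket, hi', hj', Ideal.Quotient.eq, h.add_left, h.add_right, anti a j]
  have e : br a b + -br j a + br i (b + j) - br a b = br i (b + j) - br j a := by ring
  rw [e]
  exact I.sub_mem (hI i hi _) (hI j hj _)

theorem quotientBracket_isBiderivation {br : R → R → R} (h : IsBiderivation br)
    (anti : ∀ a b, br a b = - br b a) {I : Ideal R} (hI : IsPoissonIdeal br I) :
    IsBiderivation (quotientBracket br I) := by
  constructor <;> intro a b c <;>
    obtain ⟨a, rfl⟩ := Ideal.Quotient.mk_surjective a <;>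
    obtain ⟨b, rfl⟩ := Ideal.Quotient.mk_surjective b <;>
    obtain ⟨c, rfl⟩ := Ideal.Quotient.mk_surjective c <;>
    simp only [← map_add, ← map_mul, quotientBracket_mk h anti hI]
  · rw [h.add_left]
  · rw [h.add_right]
  · rw [h.leibniz_left]
  · rw [h.leibniz_right]

/-- The quotient rule does not depend on representatives. -/
theorem fractionBracket_mk {br : R → R → R} (h : IsBiderivation br) (a b : R) (s t : R⁰) :
    fractionBracket br (IsLocalization.mk' _ a s) (IsLocalization.mk' _ b t)
      = IsLocalization.mk' _ (quotientRuleNum br a s b t) (s ^ 2 * t ^ 2) := by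
  have inj : ∀ x y : R, algebraMap R (FractionRing R) x = algebraMap R (FractionRing R) y →
      x = y := fun x y hxy => IsFractionRing.injective R (FractionRing R) hxy
  have cross : ∀ (x : R) (u : R⁰), ∃ (x' : R) (u' : R⁰),
      IsLocalization.sec R⁰ (IsLocalization.mk' (FractionRing R) x u) = (x', u') ∧
      x * u' = x' * u := by
    intro x u
    obtain ⟨x', u', hx⟩ : ∃ (x' : R) (u' : R⁰),
      IsLocalization.sec R⁰ (IsLocalization.mk' (FractionRing R) x u) = (x', u') := ⟨_, _, rfl⟩
    refine ⟨x', u', hx, ?_⟩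
    have e := IsLocalization.mk'_sec (M := R⁰) (FractionRing R)
      (IsLocalization.mk' (FractionRing R) x u)
    rw [hx, IsLocalization.mk'_eq_iff_eq] at e
    have := inj _ _ e
    linear_combination -this
  obtain ⟨a', s', e1, h1⟩ := cross a s
  obtain ⟨b', t', e2, h2⟩ := cross b t
  rw [fractionBracket, e1, e2, IsLocalization.mk'_eq_iff_eq]
  congr 1
  have hL : ∀ c, br a c * s' + a * br s' c = br a' c * s + a' * br s c := by
    intro c
    have := congrArg (fun x => br x c) h1
    simp only [h.leibniz_left] at this
    linear_combination this
  have hR : ∀ c, br c b * t' + b * br c t' = br c b' * t + b' * br c t := by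
    intro c
    have := congrArg (fun x => br c x) h2
    simp only [h.leibniz_right] at this
    linear_combination this
  have st1 : quotientRuleNum br a s b t * (s' : R) ^ 2
      = quotientRuleNum br a' s' b t * (s : R) ^ 2 := by
    have A : ∀ c, (br a c * s - br s c * a) * (s' : R) ^ 2
        = (br a' c * s' - br s' c * a') * (s : R) ^ 2 := by
      intro c
      linear_combination (s * s' : R) * hL c - (s * br s' c + s' * br s c) * h1
    simp only [quotientRuleNum]
    linear_combination (t : R) * A b - b * A t
  have st2 : quotientRuleNum br a' s' b t * (t' : R) ^ 2
      = quotientRuleNum br a' s' b' t' * (t : R) ^ 2 := by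
    have A : ∀ c, (br c b * t - br c t * b) * (t' : R) ^ 2
        = (br c b' * t' - br c t' * b') * (t : R) ^ 2 := by
      intro c
      linear_combination (t * t' : R) * hR c - (t * br c t' + t' * br c t) * h2
    simp only [quotientRuleNum]
    linear_combination (s' : R) * A a' - a' * A s'
  push_cast
  linear_combination -(t' : R) ^ 2 * st1 - (s : R) ^ 2 * st2

/-- The extension of a derivation to the ring of fractions by the quotient rule. -/
noncomputable def fractionDerivation [Algebra ℂ R] (D : Derivation ℂ R R) (z : FractionRing R) :
    FractionRing R :=
  IsLocalization.mk' (FractionRing R)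
    (D (IsLocalization.sec R⁰ z).1 * (IsLocalization.sec R⁰ z).2
      - (IsLocalization.sec R⁰ z).1 * D ((IsLocalization.sec R⁰ z).2 : R))
    ((IsLocalization.sec R⁰ z).2 ^ 2)

theorem fractionDerivation_mk [Algebra ℂ R] (D : Derivation ℂ R R) (a : R) (s : R⁰) :
    fractionDerivation D (IsLocalization.mk' _ a s)
      = IsLocalization.mk' _ (D a * s - a * D (s : R)) (s ^ 2) := by
  obtain ⟨a', s', e⟩ : ∃ (a' : R) (s' : R⁰),
    IsLocalization.sec R⁰ (IsLocalization.mk' (FractionRing R) a s) = (a', s') := ⟨_, _, rfl⟩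
  have e' := IsLocalization.mk'_sec (M := R⁰) (FractionRing R)
    (IsLocalization.mk' (FractionRing R) a s)
  rw [e, IsLocalization.mk'_eq_iff_eq] at e'
  have h1 : (s : R) * a' = s' * a := IsFractionRing.injective R (FractionRing R) e'
  have h2 := congrArg D h1
  simp only [Derivation.leibniz, smul_eq_mul] at h2
  rw [fractionDerivation, e, IsLocalization.mk'_eq_iff_eq]
  congr 1
  push_cast
  linear_combination (s * s' : R) * h2 - (s * D (s' : R) + s' * D (s : R)) * h1

/-- `P` is rational if the Poisson centre of the quotient field of `R ⧸ P` is `ℂ`. -/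
def IsPoissonRational [Algebra ℂ R] (br : R → R → R) (P : Ideal R) : Prop :=
  poissonCenter (fractionBracket (quotientBracket br P))
    = Set.range (algebraMap ℂ (FractionRing (R ⧸ P)))

/-- The Poisson Dixmier–Moeglin equivalence: for Poisson prime ideals, being locally closed (in
the Poisson spectrum), Poisson primitive and rational are equivalent. -/
def PoissonDixmierMoeglin [Algebra ℂ R] (br : R → R → R) : Prop :=
  ∀ P : PoissonSpectrum br,
    [IsLocallyClosed ({P} : Set (PoissonSpectrum br)),
      IsPoissonPrimitive br P.1, IsPoissonRational br P.1].TFAE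

end General

/-! ### The Jacobian bracket -/

/-- The polynomial algebra `ℂ[x₁, …, xₙ]`. -/
abbrev PolyRing (n : ℕ) : Type := MvPolynomial (Fin n) ℂ

/-- Its quotient field `ℂ(x₁, …, xₙ)`. -/
abbrev RatField (n : ℕ) : Type := FractionRing (PolyRing n)

/-- The derivation `∂/∂xⱼ` of `ℂ(x₁, …, xₙ)`. -/
noncomputable def ratPartial {n : ℕ} (j : Fin n) (z : RatField n) : RatField n :=
  fractionDerivation (MvPolynomial.pderiv j) z

/-- The Jacobian determinant of `n` rational functions. -/
noncomputable def jac {n : ℕ} (b : Fin n → RatField n) : RatField n :=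
  (Matrix.of fun i j => ratPartial j (b i)).det

variable {m : ℕ}

/-- With `n = m + 2`: the bracket `(t₁⋯tₙ₋₂)² Jac(f, g, s₁/t₁, …, sₙ₋₂/tₙ₋₂)` on
`ℂ(x₁, …, xₙ)`. -/
noncomputable def ratBracket (s t : Fin m → PolyRing (m + 2)) (f g : RatField (m + 2)) : RatField (m + 2) :=
  (∏ i, algebraMap (PolyRing (m + 2)) (RatField (m + 2)) (t i)) ^ 2 *
    jac (Matrix.vecCons f (Matrix.vecCons g fun i =>
      algebraMap (PolyRing (m + 2)) (RatField (m + 2)) (s i) / algebraMap _ (RatField (m + 2)) (t i)))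

/-- The restriction of `ratBracket` to `ℂ[x₁, …, xₙ]` (see `algebraMap_bracket`): the determinant
with rows `∇f`, `∇g` and `tᵢ² ∇(sᵢ/tᵢ) = tᵢ ∇sᵢ - sᵢ ∇tᵢ`. -/
noncomputable def bracket (s t : Fin m → PolyRing (m + 2)) (f g : PolyRing (m + 2)) : PolyRing (m + 2) :=
  (Matrix.of (Matrix.vecCons (fun j => MvPolynomial.pderiv j f)
    (Matrix.vecCons (fun j => MvPolynomial.pderiv j g) fun i j =>
      t i * MvPolynomial.pderiv j (s i) - s i * MvPolynomial.pderiv j (t i)))).det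

theorem ratPartial_div {n : ℕ} (j : Fin n) (a s : PolyRing n) (hs : s ≠ 0) :
    ratPartial j (algebraMap _ (RatField n) a / algebraMap _ (RatField n) s)
      = algebraMap _ (RatField n) (MvPolynomial.pderiv j a * s - a * MvPolynomial.pderiv j s)
        / algebraMap _ (RatField n) s ^ 2 := by
  have h := fractionDerivation_mk (MvPolynomial.pderiv (R := ℂ) j) a
    ⟨s, mem_nonZeroDivisors_of_ne_zero hs⟩
  rw [IsFractionRing.mk'_eq_div, IsFractionRing.mk'_eq_div, SubmonoidClass.coe_pow, map_pow] at h
  exact h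

theorem ratPartial_algebraMap {n : ℕ} (j : Fin n) (a : PolyRing n) :
    ratPartial j (algebraMap _ (RatField n) a) = algebraMap _ (RatField n) (MvPolynomial.pderiv j a) := by
  simpa using ratPartial_div j a 1 one_ne_zero

/-- `bracket` is the restriction of `ratBracket` to polynomials. -/
theorem algebraMap_bracket (s t : Fin m → PolyRing (m + 2)) (ht : ∀ i, t i ≠ 0)
    (f g : PolyRing (m + 2)) :
    algebraMap _ (RatField (m + 2)) (bracket s t f g)
      = ratBracket s t (algebraMap _ _ f) (algebraMap _ _ g) := by
  have ht' : ∀ i, algebraMap _ (RatField (m + 2)) (t i) ≠ 0 := fun i => by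
    rw [Ne, FaithfulSMul.algebraMap_eq_zero_iff]; exact ht i
  have hprod : (∏ i, algebraMap (PolyRing (m + 2)) (RatField (m + 2)) (t i)) ^ 2
      = ∏ k, (Matrix.vecCons 1 (Matrix.vecCons 1 fun i =>
          algebraMap (PolyRing (m + 2)) (RatField (m + 2)) (t i) ^ 2) : Fin (m + 2) → RatField (m + 2)) k := by
    rw [Fin.prod_univ_succ, Fin.prod_univ_succ]
    simp [Finset.prod_pow]
  rw [ratBracket, jac, hprod, ← Matrix.det_mul_column, bracket, RingHom.map_det]
  congr 1
  ext k j
  refine Fin.cases ?_ (fun k => Fin.cases ?_ (fun i => ?_) k) k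
  · simp [ratPartial_algebraMap]
  · simp [ratPartial_algebraMap]
  · simp only [RingHom.mapMatrix_apply, Matrix.map_apply, Matrix.of_apply, Matrix.cons_val_succ]
    rw [ratPartial_div j _ _ (ht i), mul_div_cancel₀ _ (pow_ne_zero 2 (ht' i)),
      mul_comm (t i)]

theorem bracket_anti (s t : Fin m → PolyRing (m + 2)) (f g : PolyRing (m + 2)) :
    bracket s t f g = - bracket s t g f := by
  have h := Matrix.det_permute (Equiv.swap (0 : Fin (m + 2)) 1)
    (Matrix.of (Matrix.vecCons (fun j => MvPolynomial.pderiv j g)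
      (Matrix.vecCons (fun j => MvPolynomial.pderiv j f) fun i j =>
        t i * MvPolynomial.pderiv j (s i) - s i * MvPolynomial.pderiv j (t i))))
  rw [Equiv.Perm.sign_swap (by simp)] at h
  simp only [Units.val_neg, Units.val_one, Int.cast_neg, Int.cast_one, neg_mul, one_mul] at h
  rw [bracket, bracket, ← h]
  congr 1
  ext k j : 2
  refine Fin.cases ?_ (fun k => Fin.cases ?_ (fun i => ?_) k) k
  · simp
  · simp
  · have : Equiv.swap (0 : Fin (m + 2)) 1 i.succ.succ = i.succ.succ :=
      Equiv.swap_apply_of_ne_of_ne (Fin.succ_ne_zero _)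
        (fun h => Fin.succ_ne_zero i (Fin.succ_injective _ (by simpa using h)))
    simp [this]

theorem bracket_isBiderivation (s t : Fin m → PolyRing (m + 2)) : IsBiderivation (bracket s t) := by
  have hadd : ∀ a b c, bracket s t (a + b) c = bracket s t a c + bracket s t b c := by
    intro a b c
    simp only [bracket, Matrix.det_succ_row_zero, ← Finset.sum_add_distrib]
    refine Finset.sum_congr rfl fun j _ => ?_
    simp only [Matrix.of_apply, Matrix.cons_val_zero, map_add, Matrix.submatrix,
      Matrix.cons_val_succ]
    ring_nf
  have hmul : ∀ a b c, bracket s t (a * b) c = a * bracket s t b c + b * bracket s t a c := by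
    intro a b c
    simp only [bracket, Matrix.det_succ_row_zero, Finset.mul_sum, ← Finset.sum_add_distrib]
    refine Finset.sum_congr rfl fun j _ => ?_
    simp only [Matrix.of_apply, Matrix.cons_val_zero, Derivation.leibniz, smul_eq_mul,
      Matrix.submatrix, Matrix.cons_val_succ]
    ring_nf
  refine ⟨hadd, fun a b c => ?_, hmul, fun a b c => ?_⟩
  · rw [bracket_anti, hadd, bracket_anti s t a b, bracket_anti s t a c]; ring
  · rw [bracket_anti, hmul, bracket_anti s t a b, bracket_anti s t a c]; ring

/-! ### The ideals and polynomials in the classification -/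

/-- The polynomials `λᵢ sᵢ - μᵢ tᵢ`. -/
noncomputable def pencil (s t : Fin m → PolyRing (m + 2)) (l u : Fin m → ℂ) (i : Fin m) :
    PolyRing (m + 2) :=
  MvPolynomial.C (l i) * s i - MvPolynomial.C (u i) * t i

/-- The ideal generated by the polynomials `λᵢ sᵢ - μᵢ tᵢ`. -/
noncomputable def pencilIdeal (s t : Fin m → PolyRing (m + 2)) (l u : Fin m → ℂ) :
    Ideal (PolyRing (m + 2)) :=
  Ideal.span (Set.range (pencil s t l u))

/-- The maximal ideal `(x₁ - p₁, …, xₙ - pₙ)`. -/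
noncomputable def pointIdeal {n : ℕ} (p : Fin n → ℂ) : Ideal (PolyRing n) :=
  Ideal.span (Set.range fun j => MvPolynomial.X j - MvPolynomial.C (p j))

/-- The polynomials `gᵢ = tᵢ(p) sᵢ - sᵢ(p) tᵢ`. -/
noncomputable def pencilAt (s t : Fin m → PolyRing (m + 2)) (p : Fin (m + 2) → ℂ) :
    Fin m → PolyRing (m + 2) :=
  pencil s t (fun i => MvPolynomial.eval p (t i)) (fun i => MvPolynomial.eval p (s i))

/-- `p` is a common zero of the `k` polynomials `g₁, …, gₖ` at which they fail the Jacobian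
criterion for a nonsingular point of codimension `k`: the matrix `(∂gᵢ/∂xⱼ(p))` has rank less
than `k`. -/
def IsJacobianSingular {n k : ℕ} (g : Fin k → PolyRing n) (p : Fin n → ℂ) : Prop :=
  (∀ i, MvPolynomial.eval p (g i) = 0) ∧
    (Matrix.of fun i j => MvPolynomial.eval p (MvPolynomial.pderiv j (g i))).rank < k

end JacobianPoisson

/-!
Write `A = ℂ[x₁, …, xₙ]`. The bracket is the determinant with rows `∇f`, `∇g` and
`wᵢ = tᵢ ∇sᵢ - sᵢ ∇tᵢ`, so each `sᵢ / tᵢ` is a Casimir: `tᵢ {sᵢ, g} = sᵢ {tᵢ, g}`. As `sᵢ` and `tᵢ`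
are coprime, bracketing with `g` multiplies both by the same polynomial, and every ideal generated
by elements `λᵢ sᵢ - μᵢ tᵢ` is Poisson (`pencilIdeal_isPoisson`). In characteristic zero the minimal
primes over an ideal stable under a derivation are stable (`derivation_mem_of_mem_minimalPrimes`);
hence Poisson primes are prime, and Poisson cores of maximal ideals are prime.

The heart of the matter is that a prime `P` containing a nontrivial `λᵢ sᵢ - μᵢ tᵢ` for every `i`
gives a surface as soon as `{a, b} ∉ P` for some `a, b`: the quotient field of `A ⧸ P` is algebraic
over `ℂ(a, b)` (`isAlgebraic_of_bracket_notMem`). Indeed a derivation of this field that kills `a`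
and `b` also kills `tᵢ dsᵢ - sᵢ dtᵢ`, because `sᵢ / tᵢ` is constant; its values at the coordinates
thus solve a linear system whose determinant is `{a, b} ≠ 0`. So the Kähler differentials over
`ℂ(a, b)` vanish, and in characteristic zero the extension is algebraic. On the other hand, elements
with nonzero bracket are algebraically independent
(`algebraicIndependent_pair_of_bracket_ne_zero`). Two consequences carry the theorem:

* Two primes, one inside the other, that contain the same pencil are equal if the larger one is
  Poisson and not residually null (`eq_of_le_of_containsPencil`). So such a prime is minimal over
  the pencil, is the Poisson core of every maximal ideal over it that omits some `{a, b} ∉ P`, and is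
  locally closed, as every larger Poisson prime contains `{a, b}`.
* The Poisson centre of the quotient field is `ℂ` (`poissonCenter_eq_range`): `a` and `b` are
  independent over the centre, and the transcendence degree is only two.

Conversely, the core of a maximal ideal `M_p` that is not Poisson contains the pencil
`tᵢ(p) sᵢ - sᵢ(p) tᵢ`, and a rational Poisson prime contains a pencil because the central elements
`sᵢ / tᵢ` of its quotient field are constants. Finally `M_p` is Poisson exactly if all brackets
vanish at `p`, that is, if the gradients at `p` of `gᵢ = tᵢ(p) sᵢ - sᵢ(p) tᵢ`, which are the vectors
`wᵢ(p)`, are linearly dependent (`isResiduallyNull_pointIdeal_iff`).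
-/

namespace JacobianPoisson

/-! ### Derivations and algebraic independence -/

section Derivations

/-- The chain rule for a derivation evaluated at a polynomial expression. -/
theorem derivation_aeval {k σ B M : Type*} [CommRing k] [Fintype σ] [CommRing B] [Algebra k B]
    [AddCommGroup M] [Module B M] [Module k M] (d : Derivation k B M) (x : σ → B)
    (p : MvPolynomial σ k) :
    d (MvPolynomial.aeval x p) = ∑ i, MvPolynomial.aeval x (MvPolynomial.pderiv i p) • d (x i) := by
  classical
  induction p using MvPolynomial.induction_on with
  | C a => simp
  | add p q hp hq => simp only [map_add, hp, hq, add_smul, Finset.sum_add_distrib]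
  | mul_X p i hp =>
    simp only [map_mul, Derivation.leibniz, hp, MvPolynomial.aeval_X, smul_eq_mul, map_add,
      MvPolynomial.pderiv_X, add_smul, Finset.sum_add_distrib, Finset.smul_sum, mul_smul]
    congr 1
    rw [Finset.sum_eq_single i]
    · simp
    · intro j _ hj
      simp [hj.symm]
    · simp

theorem eq_C_of_pderiv_eq_zero {k σ : Type*} [CommRing k] [IsDomain k] [CharZero k]
    {p : MvPolynomial σ k} (h : ∀ i, MvPolynomial.pderiv i p = 0) :
    p = MvPolynomial.C (p.coeff 0) := by
  classical
  ext c
  rw [MvPolynomial.coeff_C]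
  split_ifs with hc
  · rw [hc]
  · obtain ⟨i, hi⟩ : ∃ i, c i ≠ 0 := by
      by_contra! hall
      exact hc (Finsupp.ext fun i => (hall i).symm)
    have hle : Finsupp.single i 1 ≤ c := Finsupp.single_le_iff.mpr (Nat.one_le_iff_ne_zero.mpr hi)
    have h1 := MvPolynomial.coeff_pderiv (i := i) p (c - Finsupp.single i 1)
    rw [h i, MvPolynomial.coeff_zero, tsub_add_cancel_of_le hle] at h1
    rcases mul_eq_zero.mp h1.symm with h2 | h2
    · exact h2
    · exact absurd h2 (Nat.cast_add_one_ne_zero _)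

theorem totalDegree_pderiv_lt {k σ : Type*} [CommRing k] {p : MvPolynomial σ k} {i : σ}
    (h : MvPolynomial.pderiv i p ≠ 0) :
    (MvPolynomial.pderiv i p).totalDegree < p.totalDegree := by
  classical
  obtain ⟨c, hc, hdeg⟩ := Finset.exists_mem_eq_sup _
    (MvPolynomial.support_nonempty.mpr h) (fun s : σ →₀ ℕ => s.sum fun _ e => e)
  have hc' : (c + Finsupp.single i 1) ∈ p.support := by
    rw [MvPolynomial.mem_support_iff] at hc ⊢
    intro h0
    rw [MvPolynomial.coeff_pderiv, h0, zero_mul] at hc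
    exact hc rfl
  have h1 := MvPolynomial.le_totalDegree hc'
  rw [Finsupp.sum_add_index' (by simp) (by simp), Finsupp.sum_single_index rfl] at h1
  have h2 : (MvPolynomial.pderiv i p).totalDegree = c.sum fun _ e => e := hdeg
  omega

/-- A family of elements admitting derivations dual to it (up to nonzero factors) is
algebraically independent: a relation of least degree would have vanishing partial derivatives. -/
theorem algebraicIndependent_of_dual_derivations {k ι B : Type*} [CommRing k] [IsDomain k]
    [CharZero k] [Fintype ι] [CommRing B] [IsDomain B] [Algebra k B] [FaithfulSMul k B]
    (x : ι → B) (D : ι → Derivation k B B) (hoff : ∀ i j, j ≠ i → D i (x j) = 0)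
    (hdiag : ∀ i, D i (x i) ≠ 0) : AlgebraicIndependent k x := by
  rw [algebraicIndependent_iff]
  intro p
  induction hd : p.totalDegree using Nat.strong_induction_on generalizing p with
  | _ d ih =>
    intro hp
    have hder : ∀ i, MvPolynomial.pderiv i p = 0 := by
      intro i
      by_contra hne
      refine hne (ih _ (hd ▸ totalDegree_pderiv_lt hne) _ rfl ?_)
      have h1 := derivation_aeval (D i) x p
      rw [hp, map_zero, Finset.sum_eq_single i (fun j _ hj => by rw [hoff i j hj, smul_zero])
        (by simp), smul_eq_mul] at h1
      exact (mul_eq_zero.mp h1.symm).resolve_right (hdiag i)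
    have hC := eq_C_of_pderiv_eq_zero hder
    rw [hC, MvPolynomial.aeval_C, FaithfulSMul.algebraMap_eq_zero_iff] at hp
    rw [hC, hp, map_zero]

end Derivations

/-! ### Minimal primes over ideals stable under a derivation -/

section StableIdeals

variable {k R : Type*} [CommRing k] [CommRing R] [Algebra k R]

theorem derivation_iterate_mul (D : Derivation k R R) (n : ℕ) (a b : R) :
    D^[n] (a * b) =
      ∑ ij ∈ Finset.HasAntidiagonal.antidiagonal n,
        (n.choose ij.1 : R) * (D^[ij.1] a * D^[ij.2] b) := by
  have hsum := Finset.sum_antidiagonal_choose_succ_mul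
    (fun i j => D^[i] a * D^[j] b)
  induction n with
  | zero => simp
  | succ n ih =>
    rw [Function.iterate_succ_apply', ih, map_sum, hsum, ← Finset.sum_add_distrib]
    refine Finset.sum_congr rfl fun ij hij => ?_
    have hc : D (n.choose ij.1 : R) = 0 := D.map_natCast _
    have hch : (n.choose ij.2 : R) = n.choose ij.1 := by
      rw [Nat.choose_symm_of_eq_add (Finset.HasAntidiagonal.mem_antidiagonal.mp hij).symm]
    simp only [Derivation.leibniz, hc, smul_eq_mul, Function.iterate_succ_apply', hch]
    ring

/-- The largest ideal stable under `D` that is contained in `P`. -/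
def derivationCore (D : Derivation k R R) (P : Ideal R) : Ideal R where
  carrier := {a | ∀ n, D^[n] a ∈ P}
  zero_mem' n := by
    rw [show D^[n] 0 = 0 from Function.iterate_fixed (map_zero D) n]
    exact P.zero_mem
  add_mem' {a b} ha hb n := by
    rw [iterate_map_add D n a b]
    exact P.add_mem (ha n) (hb n)
  smul_mem' r a ha n := by
    rw [smul_eq_mul, derivation_iterate_mul]
    exact P.sum_mem fun ij _ => P.mul_mem_left _ (P.mul_mem_left _ (ha _))

theorem derivationCore_isPrime [Algebra ℚ R] (D : Derivation k R R) (P : Ideal R) [hP : P.IsPrime] :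
    (derivationCore D P).IsPrime := by
  classical
  refine ⟨fun h => hP.ne_top ((Ideal.eq_top_iff_one P).mpr
    ((h ▸ Submodule.mem_top : (1 : R) ∈ derivationCore D P) 0)), fun {a b} hab => ?_⟩
  by_contra! hcon
  have ha : ∃ n, D^[n] a ∉ P := by
    by_contra! h
    exact hcon.1 h
  have hb : ∃ n, D^[n] b ∉ P := by
    by_contra! h
    exact hcon.2 h
  -- modulo `P`, only the term of lowest orders survives in the Leibniz expansion
  have hsum := hab (Nat.find ha + Nat.find hb)
  rw [derivation_iterate_mul, ← Finset.add_sum_erase _ _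
    (Finset.HasAntidiagonal.mem_antidiagonal.mpr rfl : (Nat.find ha, Nat.find hb) ∈ _)] at hsum
  have hrest := (P.add_mem_iff_left (P.sum_mem fun ij hij => ?_)).mp hsum
  · rcases hP.mem_or_mem hrest with h | h
    · have hne : ((Nat.find ha + Nat.find hb).choose (Nat.find ha) : ℚ) ≠ 0 := by
        exact_mod_cast (Nat.choose_pos (Nat.le_add_right _ _)).ne'
      refine hP.ne_top ((Ideal.eq_top_iff_one P).mpr ?_)
      have h1 := P.mul_mem_left (algebraMap ℚ R
        (((Nat.find ha + Nat.find hb).choose (Nat.find ha) : ℚ)⁻¹)) h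
      rwa [← map_natCast (algebraMap ℚ R), ← map_mul, inv_mul_cancel₀ hne, map_one] at h1
    · exact (hP.mem_or_mem h).elim (Nat.find_spec ha) (Nat.find_spec hb)
  · obtain ⟨hne, hmem⟩ := Finset.mem_erase.mp hij
    rw [Finset.HasAntidiagonal.mem_antidiagonal] at hmem
    refine P.mul_mem_left _ ?_
    rcases lt_trichotomy ij.1 (Nat.find ha) with h | h | h
    · exact P.mul_mem_right _ (not_not.mp (Nat.find_min ha h))
    · exact absurd (Prod.ext h (by omega)) hne
    · exact P.mul_mem_left _ (not_not.mp (Nat.find_min hb (by omega)))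

theorem derivation_mem_of_mem_minimalPrimes [Algebra ℚ R] (D : Derivation k R R) {I P : Ideal R}
    (hI : ∀ x ∈ I, D x ∈ I) (hP : P ∈ I.minimalPrimes) : ∀ x ∈ P, D x ∈ P := by
  have := hP.1.1
  have hle : I ≤ derivationCore D P := by
    intro x hx n
    refine hP.1.2 ?_
    induction n generalizing x with
    | zero => exact hx
    | succ n ih => exact ih (hI x hx)
  exact fun x hx => hP.2 ⟨derivationCore_isPrime D P, hle⟩ (fun y hy => hy 0) hx 1

end StableIdeals

/-! ### Poisson ideals and Poisson primes -/

section Poisson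

variable {k R : Type*} [CommRing k] [CommRing R] [Algebra k R] {br : R → R → R}

/-- The Hamiltonian derivation `{·, r}` of a bracket that vanishes on scalars. -/
def hamiltonian (h : IsBiderivation br) (hk : ∀ (c : k) (r : R), br (algebraMap k R c) r = 0)
    (r : R) : Derivation k R R :=
  Derivation.mk'
    { toFun := fun a => br a r
      map_add' := fun a b => h.add_left a b r
      map_smul' := fun c a => by
        rw [Algebra.smul_def, h.leibniz_left, hk, mul_zero, add_zero, RingHom.id_apply,
          Algebra.smul_def] }
    fun a b => h.leibniz_left a b r

/-- If `{a, b} ≠ 0` then `a` and `b` are algebraically independent over any ring of scalars on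
which the bracket vanishes. -/
theorem algebraicIndependent_pair_of_bracket_ne_zero [IsDomain k] [CharZero k] [IsDomain R]
    [FaithfulSMul k R] (h : IsBiderivation br) (anti : ∀ a b, br a b = - br b a)
    (hk : ∀ (c : k) (r : R), br (algebraMap k R c) r = 0) {a b : R} (hab : br a b ≠ 0) :
    AlgebraicIndependent k ![a, b] := by
  have : CharZero R := charZero_of_injective_algebraMap (FaithfulSMul.algebraMap_injective k R)
  have hself : ∀ r, br r r = 0 := fun r => CharZero.eq_neg_self_iff.mp (anti r r)
  refine algebraicIndependent_of_dual_derivations _ ![hamiltonian h hk b, hamiltonian h hk a]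
    (fun i j hij => ?_) (fun i => ?_)
  · fin_cases i <;> fin_cases j
    · exact absurd rfl hij
    · exact hself b
    · exact hself a
    · exact absurd rfl hij
  · fin_cases i
    · exact hab
    · change br b a ≠ 0
      rwa [anti b a, neg_ne_zero]

theorem isPoissonIdeal_of_isResiduallyNull {I : Ideal R} (h : IsResiduallyNull br I) :
    IsPoissonIdeal br I := fun i _ r => h i r

theorem IsPoissonIdeal.mul (h : IsBiderivation br) {I J : Ideal R} (hI : IsPoissonIdeal br I)
    (hJ : IsPoissonIdeal br J) : IsPoissonIdeal br (I * J) := by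
  intro x hx r
  have h0 : br 0 r = 0 := by simpa using h.add_left 0 0 r
  induction hx using Submodule.mul_induction_on' with
  | mem_mul_mem i hi j hj =>
    rw [h.leibniz_left, mul_comm j]
    exact Ideal.add_mem _ (Ideal.mul_mem_mul hi (hJ j hj r)) (Ideal.mul_mem_mul (hI i hi r) hj)
  | add x _ y _ hx hy =>
    rw [h.add_left]
    exact Ideal.add_mem _ hx hy

theorem IsPoissonIdeal.of_mem_minimalPrimes [Algebra ℚ R] (h : IsBiderivation br)
    (hk : ∀ (c : k) (r : R), br (algebraMap k R c) r = 0) {I P : Ideal R}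
    (hI : IsPoissonIdeal br I) (hP : P ∈ I.minimalPrimes) : IsPoissonIdeal br P :=
  fun i hi r => derivation_mem_of_mem_minimalPrimes (hamiltonian h hk r)
    (fun x hx => hI x hx r) hP i hi

theorem poissonCore_isPoisson (h : IsBiderivation br) (I : Ideal R) :
    IsPoissonIdeal br (poissonCore br I) := (poissonCore_isGreatest h I).1.1

theorem poissonCore_le (h : IsBiderivation br) (I : Ideal R) : poissonCore br I ≤ I :=
  (poissonCore_isGreatest h I).1.2

theorem le_poissonCore {I J : Ideal R} (hJ : IsPoissonIdeal br J) (hJI : J ≤ I) :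
    J ≤ poissonCore br I := le_sSup ⟨hJ, hJI⟩

theorem poissonCore_isPrime [Algebra ℚ R] (h : IsBiderivation br)
    (hk : ∀ (c : k) (r : R), br (algebraMap k R c) r = 0) (M : Ideal R) [M.IsPrime] :
    (poissonCore br M).IsPrime := by
  obtain ⟨Q, hQ, hQM⟩ := Ideal.exists_minimalPrimes_le (poissonCore_le h M)
  have hQP := (poissonCore_isPoisson h M).of_mem_minimalPrimes h hk hQ
  have : poissonCore br M = Q := le_antisymm hQ.1.2 (le_poissonCore hQP hQM)
  rw [this]
  exact hQ.1.1

theorem IsPoissonPrime.isPrime [Algebra ℚ R] [IsNoetherianRing R] (h : IsBiderivation br)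
    (hk : ∀ (c : k) (r : R), br (algebraMap k R c) r = 0) {P : Ideal R}
    (hP : IsPoissonPrime br P) : P.IsPrime := by
  have htop : IsPoissonIdeal br ⊤ := fun _ _ _ => Submodule.mem_top
  have hpow : ∀ (J : Ideal R) (n : ℕ), IsPoissonIdeal br J → J ^ n ≤ P → J ≤ P := by
    intro J n hJ
    have hJn : ∀ n, IsPoissonIdeal br (J ^ n) := by
      intro n
      induction n with
      | zero => rwa [pow_zero, Ideal.one_eq_top]
      | succ n ih => rw [pow_succ]; exact ih.mul h hJ
    induction n with
    | zero =>
      intro hle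
      rw [pow_zero, Ideal.one_eq_top] at hle
      exact le_top.trans hle
    | succ n ih =>
      intro hle
      rw [pow_succ] at hle
      exact (hP.le_or_le _ _ (hJn n) hJ hle).elim ih id
  have hprod : ∀ s : Finset (Ideal R), (∀ Q ∈ s, IsPoissonIdeal br Q) →
      IsPoissonIdeal br (∏ Q ∈ s, Q) ∧ (∏ Q ∈ s, Q ≤ P → ∃ Q ∈ s, Q ≤ P) := by
    classical
    intro s
    induction s using Finset.induction_on with
    | empty =>
      intro _
      simp only [Finset.prod_empty, Ideal.one_eq_top]
      exact ⟨htop, fun hle => absurd (top_le_iff.mp hle) hP.ne_top⟩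
    | insert Q s hQs ih =>
      intro hs
      obtain ⟨h1, h2⟩ := ih fun Q' hQ' => hs Q' (Finset.mem_insert_of_mem hQ')
      rw [Finset.prod_insert hQs]
      refine ⟨(hs Q (Finset.mem_insert_self _ _)).mul h h1, fun hle => ?_⟩
      rcases hP.le_or_le _ _ (hs Q (Finset.mem_insert_self _ _)) h1 hle with h3 | h3
      · exact ⟨Q, Finset.mem_insert_self _ _, h3⟩
      · obtain ⟨Q', hQ', h4⟩ := h2 h3
        exact ⟨Q', Finset.mem_insert_of_mem hQ', h4⟩
  obtain ⟨n, hn⟩ := P.exists_radical_pow_le_of_fg P.radical.fg_of_isNoetherianRing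
  have hfin := P.finite_minimalPrimes_of_isNoetherianRing
  obtain ⟨hs1, hs2⟩ := hprod hfin.toFinset fun Q hQ =>
    hP.isPoisson.of_mem_minimalPrimes h hk (hfin.mem_toFinset.mp hQ)
  have hle : ∏ Q ∈ hfin.toFinset, Q ≤ P.radical := by
    rw [← Ideal.sInf_minimalPrimes]
    refine le_sInf fun Q hQ => ?_
    exact Ideal.prod_le_inf.trans (Finset.inf_le (f := fun Q : Ideal R => Q)
      (hfin.mem_toFinset.mpr hQ))
  obtain ⟨Q, hQ, hQP⟩ := hs2 (hpow _ n hs1 ((Ideal.pow_right_mono hle n).trans hn))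
  have hQ' := hfin.mem_toFinset.mp hQ
  rw [le_antisymm hQ'.1.2 hQP]
  exact hQ'.1.1

theorem IsPoissonIdeal.isPoissonPrime {P : Ideal R} (hP : IsPoissonIdeal br P) [hp : P.IsPrime] :
    IsPoissonPrime br P :=
  ⟨hP, hp.ne_top, fun _ _ _ _ hle => hp.mul_le.mp hle⟩

end Poisson

/-! ### The Jacobian bracket: scalars, Casimirs and pencils -/

section Bracket

variable {m : ℕ} (s t : Fin m → PolyRing (m + 2))

theorem map_bracket {S : Type*} [CommRing S] (φ : PolyRing (m + 2) →+* S)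
    (f g : PolyRing (m + 2)) :
    φ (bracket s t f g) =
      (Matrix.of (Matrix.vecCons (fun j => φ (MvPolynomial.pderiv j f))
        (Matrix.vecCons (fun j => φ (MvPolynomial.pderiv j g)) fun i j =>
          φ (t i) * φ (MvPolynomial.pderiv j (s i))
            - φ (s i) * φ (MvPolynomial.pderiv j (t i))))).det := by
  rw [bracket, RingHom.map_det]
  congr 1
  ext k j
  refine Fin.cases ?_ (fun k => Fin.cases ?_ (fun i => ?_) k) k <;> simp

theorem bracket_algebraMap_left (c : ℂ) (g : PolyRing (m + 2)) :
    bracket s t (algebraMap ℂ _ c) g = 0 :=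
  Matrix.det_eq_zero_of_row_eq_zero 0 fun j => by simp

theorem bracket_C_left (c : ℂ) (g : PolyRing (m + 2)) :
    bracket s t (MvPolynomial.C c) g = 0 := bracket_algebraMap_left s t c g

theorem bracket_C_mul_left (c : ℂ) (f g : PolyRing (m + 2)) :
    bracket s t (MvPolynomial.C c * f) g = MvPolynomial.C c * bracket s t f g := by
  rw [(bracket_isBiderivation s t).leibniz_left, bracket_C_left, mul_zero, add_zero]

theorem bracket_sub_left (f f' g : PolyRing (m + 2)) :
    bracket s t (f - f') g = bracket s t f g - bracket s t f' g := by
  have := (bracket_isBiderivation s t).add_left (f - f') f' g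
  rw [sub_add_cancel] at this
  rw [this, add_sub_cancel_right]

/-- The quotient `sᵢ / tᵢ` is a Casimir, stated without denominators. -/
theorem mul_bracket_eq_mul_bracket (i : Fin m) (g : PolyRing (m + 2)) :
    t i * bracket s t (s i) g = s i * bracket s t (t i) g := by
  have hrow : (Matrix.of (Matrix.vecCons
      (fun j => t i * MvPolynomial.pderiv j (s i) - s i * MvPolynomial.pderiv j (t i))
      (Matrix.vecCons (fun j => MvPolynomial.pderiv j g) fun i j =>
        t i * MvPolynomial.pderiv j (s i) - s i * MvPolynomial.pderiv j (t i)))).det = 0 :=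
    Matrix.det_zero_of_row_eq (i := 0) (j := i.succ.succ) (Fin.succ_ne_zero _).symm
      (by ext j; simp)
  rw [← sub_eq_zero, ← hrow]
  simp only [bracket]
  rw [Matrix.det_succ_row_zero, Matrix.det_succ_row_zero, Matrix.det_succ_row_zero, Finset.mul_sum,
    Finset.mul_sum, ← Finset.sum_sub_distrib]
  refine Finset.sum_congr rfl fun j _ => ?_
  simp only [Matrix.of_apply, Matrix.cons_val_zero, Matrix.submatrix, Matrix.cons_val_succ]
  ring

variable {s t}

/-- By coprimality, bracketing with `g` multiplies `sᵢ` and `tᵢ` by a common polynomial. -/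
theorem exists_bracket_eq_mul (ht : ∀ i, t i ≠ 0) (hst : ∀ i, IsRelPrime (s i) (t i)) (i : Fin m)
    (g : PolyRing (m + 2)) :
    ∃ h, bracket s t (s i) g = s i * h ∧ bracket s t (t i) g = t i * h := by
  have hc := mul_bracket_eq_mul_bracket s t i g
  obtain ⟨h, hh⟩ : t i ∣ bracket s t (t i) g :=
    (hst i).symm.dvd_of_dvd_mul_left (Dvd.intro _ hc)
  refine ⟨h, mul_left_cancel₀ (ht i) ?_, hh⟩
  rw [hc, hh]
  ring

theorem pencilIdeal_isPoisson (ht : ∀ i, t i ≠ 0) (hst : ∀ i, IsRelPrime (s i) (t i))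
    (l u : Fin m → ℂ) : IsPoissonIdeal (bracket s t) (pencilIdeal s t l u) := by
  intro x hx r
  refine Submodule.span_induction (p := fun x _ => bracket s t x r ∈ pencilIdeal s t l u)
    ?_ ?_ ?_ ?_ hx
  · rintro _ ⟨i, rfl⟩
    obtain ⟨h, h1, h2⟩ := exists_bracket_eq_mul ht hst i r
    have : bracket s t (pencil s t l u i) r = h * pencil s t l u i := by
      rw [pencil, bracket_sub_left, bracket_C_mul_left, bracket_C_mul_left, h1, h2]
      ring
    rw [this]
    exact Ideal.mul_mem_left _ _ (Ideal.subset_span ⟨i, rfl⟩)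
  · rw [← map_zero MvPolynomial.C, bracket_C_left]
    exact Ideal.zero_mem _
  · intro x y _ _ hx hy
    rw [(bracket_isBiderivation s t).add_left]
    exact Ideal.add_mem _ hx hy
  · intro a x hx hbr
    rw [smul_eq_mul, (bracket_isBiderivation s t).leibniz_left]
    exact Ideal.add_mem _ (Ideal.mul_mem_left _ _ hbr) (Ideal.mul_mem_right _ _ hx)

end Bracket

/-! ### Transcendence degree of the quotients by primes containing a pencil -/

section Transcendence

open IntermediateField.algebraAdjoinAdjoin in
theorem isAlgebraic_adjoin_of_kaehlerDifferential {K : Type*} [Field K] [Algebra ℂ K]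
    [Algebra.EssFiniteType ℂ K] (S : Set K)
    (h : ∀ z, KaehlerDifferential.D (IntermediateField.adjoin ℂ S) K z = 0) :
    Algebra.IsAlgebraic (Algebra.adjoin ℂ S) K := by
  have hsub : Subsingleton (Ω[K⁄IntermediateField.adjoin ℂ S]) := by
    rw [← Submodule.subsingleton_iff K, ← subsingleton_iff_bot_eq_top,
      ← KaehlerDifferential.span_range_derivation, eq_comm, Submodule.span_eq_bot]
    rintro _ ⟨z, rfl⟩
    exact h z
  have : Algebra.FormallyUnramified (IntermediateField.adjoin ℂ S) K := ⟨hsub⟩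
  have : Algebra.EssFiniteType (IntermediateField.adjoin ℂ S) K :=
    Algebra.EssFiniteType.of_comp ℂ _ K
  have : Algebra.IsSeparable (IntermediateField.adjoin ℂ S) K :=
    (Algebra.FormallyUnramified.iff_isSeparable _ _).mp inferInstance
  exact (IsFractionRing.comap_isAlgebraic_iff (A := Algebra.adjoin ℂ S)
    (K := IntermediateField.adjoin ℂ S)).mpr inferInstance

variable {m : ℕ} {s t : Fin m → PolyRing (m + 2)}

/-- The residue class of a polynomial in the quotient field of `A ⧸ P`. -/
noncomputable def residue {n : ℕ} (P : Ideal (PolyRing n)) :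
    PolyRing n →ₐ[ℂ] FractionRing (PolyRing n ⧸ P) :=
  (IsScalarTower.toAlgHom ℂ (PolyRing n ⧸ P) (FractionRing (PolyRing n ⧸ P))).comp
    (Ideal.Quotient.mkₐ ℂ P)

theorem residue_apply {n : ℕ} (P : Ideal (PolyRing n)) (f : PolyRing n) :
    residue P f = algebraMap (PolyRing n ⧸ P) _ (Ideal.Quotient.mk P f) := rfl

theorem residue_eq_zero_iff {n : ℕ} {P : Ideal (PolyRing n)} {f : PolyRing n} :
    residue P f = 0 ↔ f ∈ P := by
  rw [residue_apply, FaithfulSMul.algebraMap_eq_zero_iff, Ideal.Quotient.eq_zero_iff_mem]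

/-- The ideal `P` contains, for every `i`, a nontrivial member of the pencil spanned by `sᵢ`
and `tᵢ`. -/
def ContainsPencil (s t : Fin m → PolyRing (m + 2)) (P : Ideal (PolyRing (m + 2))) : Prop :=
  ∃ l u : Fin m → ℂ, (∀ i, (l i, u i) ≠ (0, 0)) ∧ pencilIdeal s t l u ≤ P

theorem eq_zero_of_sum_smul_eq_zero {K V ι : Type*} [Field K] [AddCommGroup V] [Module K V]
    [Fintype ι] [DecidableEq ι] {M : Matrix ι ι K} (hM : M.det ≠ 0) {v : ι → V}
    (h : ∀ k, ∑ j, M k j • v j = 0) (j : ι) : v j = 0 := by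
  refine (smul_eq_zero.mp (?_ : M.det • v j = 0)).resolve_left hM
  calc M.det • v j
      = ∑ i, (M.adjugate * M) j i • v i := by
        rw [Matrix.adjugate_mul, Finset.sum_eq_single j]
        · simp
        · intro i _ hij
          simp [hij.symm]
        · simp
    _ = ∑ k, M.adjugate j k • ∑ i, M k i • v i := by
        simp only [Matrix.mul_apply, Finset.sum_smul, Finset.smul_sum, mul_smul]
        exact Finset.sum_comm
    _ = 0 := by simp only [h, smul_zero, Finset.sum_const_zero]

/-- If `s / t` is a constant, then so is its differential. -/
theorem smul_derivation_sub_eq_zero {K V : Type*} [Field K] [Algebra ℂ K] [AddCommGroup V]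
    [Module K V] [Module ℂ V] (d : Derivation ℂ K V) {l u : ℂ} (hlu : (l, u) ≠ (0, 0)) {s t : K}
    (h : algebraMap ℂ K l * s - algebraMap ℂ K u * t = 0) : t • d s - s • d t = 0 := by
  rw [sub_eq_zero] at h
  have hd := congrArg d h
  simp only [d.leibniz, d.map_algebraMap, smul_zero, add_zero] at hd
  have hne : algebraMap ℂ K l ≠ 0 ∨ algebraMap ℂ K u ≠ 0 := by
    simp only [Ne, FaithfulSMul.algebraMap_eq_zero_iff]
    by_contra! hcon
    exact hlu (Prod.ext hcon.1 hcon.2)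
  rcases hne with hne | hne
  · refine (smul_eq_zero.mp ?_).resolve_left hne
    rw [smul_sub, smul_comm, hd, smul_smul, smul_smul, h, mul_comm, sub_self]
  · refine (smul_eq_zero.mp ?_).resolve_left hne
    rw [smul_sub, smul_smul, ← h, smul_comm _ s, ← hd, smul_smul, mul_comm, sub_self]

/-- On a field over which the pencil has a zero, a derivation that kills `a` and `b` also kills
every `tᵢ dsᵢ - sᵢ dtᵢ`; so its values at the coordinates solve the homogeneous linear system
whose determinant is the image of `{a, b}`. -/
theorem derivation_eq_zero_of_bracket_ne_zero {K V : Type*} [Field K] [Algebra ℂ K]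
    [AddCommGroup V] [Module K V] [Module ℂ V] (φ : PolyRing (m + 2) →ₐ[ℂ] K)
    (d : Derivation ℂ K V) {l u : Fin m → ℂ} (hlu : ∀ i, (l i, u i) ≠ (0, 0))
    (hφ : ∀ i, φ (pencil s t l u i) = 0) {a b : PolyRing (m + 2)}
    (hab : φ (bracket s t a b) ≠ 0) (ha : d (φ a) = 0) (hb : d (φ b) = 0)
    (f : PolyRing (m + 2)) : d (φ f) = 0 := by
  have hchain : ∀ f, d (φ f) =
      ∑ j, φ (MvPolynomial.pderiv j f) • d (φ (MvPolynomial.X j)) := by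
    intro f
    have := derivation_aeval d (fun j => φ (MvPolynomial.X j)) f
    have hφ : φ = MvPolynomial.aeval fun j => φ (MvPolynomial.X j) := MvPolynomial.aeval_unique φ
    rwa [← hφ] at this
  have hw : ∀ i, φ (t i) • d (φ (s i)) - φ (s i) • d (φ (t i)) = 0 := by
    intro i
    have h := hφ i
    rw [pencil, map_sub, map_mul, map_mul] at h
    exact smul_derivation_sub_eq_zero d (hlu i)
      (by rw [← φ.commutes, ← φ.commutes]; exact h)
  rw [← AlgHom.coe_toRingHom, map_bracket] at hab
  rw [hchain]
  refine Finset.sum_eq_zero fun j _ => ?_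
  rw [eq_zero_of_sum_smul_eq_zero hab (v := fun j => d (φ (MvPolynomial.X j))) ?_ j, smul_zero]
  intro k
  refine Fin.cases ?_ (fun k => Fin.cases ?_ (fun i => ?_) k) k
  · exact (hchain a).symm.trans ha
  · exact (hchain b).symm.trans hb
  · rw [← hw i, hchain, hchain, Finset.smul_sum, Finset.smul_sum, ← Finset.sum_sub_distrib]
    refine Finset.sum_congr rfl fun j _ => ?_
    rw [smul_smul, smul_smul, ← sub_smul]
    rfl

/-- A field generated by the image of `A`, over which the pencil has a zero, is algebraic over
`ℂ(a, b)` if the image of `{a, b}` is nonzero, as it has no nonzero derivation over `ℂ(a, b)`. -/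
theorem isAlgebraic_of_bracket_ne_zero {K : Type*} [Field K] [Algebra ℂ K]
    [Algebra.EssFiniteType ℂ K] (φ : PolyRing (m + 2) →ₐ[ℂ] K)
    (hφsurj : ∀ z : K, ∃ x y, φ x / φ y = z) {l u : Fin m → ℂ} (hlu : ∀ i, (l i, u i) ≠ (0, 0))
    (hφ : ∀ i, φ (pencil s t l u i) = 0) {a b : PolyRing (m + 2)}
    (hab : φ (bracket s t a b) ≠ 0) :
    Algebra.IsAlgebraic (Algebra.adjoin ℂ (Set.range ![φ a, φ b])) K := by
  refine isAlgebraic_adjoin_of_kaehlerDifferential _ fun z => ?_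
  generalize KaehlerDifferential.D (IntermediateField.adjoin ℂ (Set.range ![φ a, φ b])) K = d
  have ha : d (φ a) = 0 :=
    d.map_algebraMap ⟨φ a, IntermediateField.subset_adjoin _ _ ⟨0, rfl⟩⟩
  have hb : d (φ b) = 0 :=
    d.map_algebraMap ⟨φ b, IntermediateField.subset_adjoin _ _ ⟨1, rfl⟩⟩
  have hres : ∀ f, d (φ f) = 0 :=
    derivation_eq_zero_of_bracket_ne_zero φ (d.restrictScalars ℂ) hlu hφ hab ha hb
  obtain ⟨x, y, rfl⟩ := hφsurj z
  rw [Derivation.leibniz_div, hres, hres, smul_zero, smul_zero, sub_zero, smul_zero]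

theorem exists_residue_div_residue {n : ℕ} (P : Ideal (PolyRing n)) [P.IsPrime]
    (z : FractionRing (PolyRing n ⧸ P)) :
    ∃ x y, residue P y ≠ 0 ∧ residue P x / residue P y = z := by
  obtain ⟨x, y, hy, rfl⟩ := IsFractionRing.div_surjective (A := PolyRing n ⧸ P) z
  obtain ⟨x, rfl⟩ := Ideal.Quotient.mk_surjective x
  obtain ⟨y, rfl⟩ := Ideal.Quotient.mk_surjective y
  refine ⟨x, y, ?_, rfl⟩
  rw [residue_apply, Ne, FaithfulSMul.algebraMap_eq_zero_iff]
  exact nonZeroDivisors.ne_zero hy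

/-- If `P` contains a pencil and `{a, b} ∉ P`, then the quotient field of `A ⧸ P` is algebraic over
`ℂ(a, b)`. -/
theorem isAlgebraic_of_bracket_notMem {P : Ideal (PolyRing (m + 2))} [P.IsPrime]
    (hP : ContainsPencil s t P) {a b : PolyRing (m + 2)} (hab : bracket s t a b ∉ P) :
    Algebra.IsAlgebraic (Algebra.adjoin ℂ (Set.range ![residue P a, residue P b]))
      (FractionRing (PolyRing (m + 2) ⧸ P)) := by
  obtain ⟨l, u, hlu, hle⟩ := hP
  exact isAlgebraic_of_bracket_ne_zero (residue P)
    (fun z => let ⟨x, y, _, h⟩ := exists_residue_div_residue P z; ⟨x, y, h⟩) hlu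
    (fun i => residue_eq_zero_iff.mpr (hle (Ideal.subset_span ⟨i, rfl⟩)))
    (residue_eq_zero_iff.not.mpr hab)

theorem algHom_aeval_pair {B C : Type*} [CommRing B] [CommRing C] [Algebra ℂ B] [Algebra ℂ C]
    (φ : B →ₐ[ℂ] C) (a b : B) (p : MvPolynomial (Fin 2) ℂ) :
    φ (MvPolynomial.aeval ![a, b] p) = MvPolynomial.aeval ![φ a, φ b] p := by
  rw [← AlgHom.comp_apply, MvPolynomial.comp_aeval]
  congr 2
  ext i
  fin_cases i <;> rfl

/-- Elements with `{a, b} ∉ P` have algebraically independent residue classes. -/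
theorem algebraicIndependent_of_bracket_notMem {P : Ideal (PolyRing (m + 2))} [P.IsPrime]
    (hP : IsPoissonIdeal (bracket s t) P) {a b : PolyRing (m + 2)} (hab : bracket s t a b ∉ P) :
    AlgebraicIndependent ℂ ![Ideal.Quotient.mk P a, Ideal.Quotient.mk P b] := by
  have hbi := bracket_isBiderivation s t
  have anti := bracket_anti s t
  refine algebraicIndependent_pair_of_bracket_ne_zero (quotientBracket_isBiderivation hbi anti hP)
    (fun x y => ?_) (fun c x => ?_) (?_ : quotientBracket (bracket s t) P _ _ ≠ 0)
  · obtain ⟨x, rfl⟩ := Ideal.Quotient.mk_surjective x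
    obtain ⟨y, rfl⟩ := Ideal.Quotient.mk_surjective y
    rw [quotientBracket_mk hbi anti hP, quotientBracket_mk hbi anti hP, anti, map_neg]
  · obtain ⟨x, rfl⟩ := Ideal.Quotient.mk_surjective x
    change quotientBracket _ P (Ideal.Quotient.mk P (algebraMap ℂ _ c)) _ = 0
    rw [quotientBracket_mk hbi anti hP, bracket_algebraMap_left, map_zero]
  · rwa [quotientBracket_mk hbi anti hP, Ne, Ideal.Quotient.eq_zero_iff_mem]

/-- If `f ∈ P` were not in `Q`, it would be algebraic over `ℂ[a, b]` modulo `Q`, and a nonzero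
constant coefficient of an equation for `f` would be a relation between `a` and `b` modulo `P`. -/
theorem eq_of_le_of_containsPencil {Q P : Ideal (PolyRing (m + 2))} [Q.IsPrime] [P.IsPrime]
    (hP : IsPoissonIdeal (bracket s t) P) (hnull : ¬ IsResiduallyNull (bracket s t) P)
    (hQ : ContainsPencil s t Q) (hQP : Q ≤ P) : Q = P := by
  refine le_antisymm hQP fun f hf => ?_
  by_contra hfQ
  simp only [IsResiduallyNull, not_forall] at hnull
  obtain ⟨a, b, hab⟩ := hnull
  have halg := isAlgebraic_of_bracket_notMem hQ (fun h => hab (hQP h))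
  obtain ⟨q, hq0, hq⟩ := (halg.isAlgebraic (residue Q f)).exists_nonzero_coeff_and_aeval_eq_zero
    (mem_nonZeroDivisors_of_ne_zero (residue_eq_zero_iff.not.mpr hfQ))
  have hlift : ∀ c : Algebra.adjoin ℂ (Set.range ![residue Q a, residue Q b]),
      ∃ p : MvPolynomial (Fin 2) ℂ, residue Q (MvPolynomial.aeval ![a, b] p) = c := by
    rintro ⟨c, hc⟩
    rw [Algebra.adjoin_range_eq_range_aeval] at hc
    obtain ⟨p, hp⟩ := hc
    exact ⟨p, (algHom_aeval_pair _ _ _ _).trans hp⟩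
  choose p hp using hlift
  have hsum : ∑ i ∈ Finset.range (q.natDegree + 1),
      MvPolynomial.aeval ![a, b] (p (q.coeff i)) * f ^ i ∈ Q := by
    rw [← residue_eq_zero_iff, ← hq, Polynomial.aeval_eq_sum_range, map_sum]
    refine Finset.sum_congr rfl fun i _ => ?_
    rw [map_mul, map_pow, hp]
    rfl
  -- the terms of positive degree lie in `P`, hence so does the constant coefficient
  rw [Finset.sum_range_succ', pow_zero, mul_one] at hsum
  have h0 := (P.add_mem_iff_right (P.sum_mem fun i _ => P.mul_mem_left _
    (Ideal.pow_mem_of_mem P hf _ i.succ_pos))).mp (hQP hsum)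
  have hind := algebraicIndependent_iff.mp (algebraicIndependent_of_bracket_notMem hP hab)
    (p (q.coeff 0)) ((algHom_aeval_pair (Ideal.Quotient.mkₐ ℂ P) a b _).symm.trans
      (Ideal.Quotient.eq_zero_iff_mem.mpr h0))
  refine hq0 (Subtype.ext ?_)
  rw [← hp, hind, map_zero, map_zero]
  rfl

end Transcendence

/-! ### Poisson maximal ideals -/

section Points

/-- The Jacobian criterion for algebraic independence: the columns of the adjugate matrix give
dual derivations. -/
theorem algebraicIndependent_of_det_pderiv_ne_zero {n : ℕ} (h : Fin n → PolyRing n)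
    (hdet : (Matrix.of fun i j => MvPolynomial.pderiv j (h i)).det ≠ 0) :
    AlgebraicIndependent ℂ h := by
  set M := Matrix.of fun i j => MvPolynomial.pderiv j (h i) with hM
  have happly : ∀ i k, (∑ j, M.adjugate j i • MvPolynomial.pderiv j :
      Derivation ℂ (PolyRing n) (PolyRing n)) (h k) = (M * M.adjugate) k i := by
    intro i k
    rw [Matrix.mul_apply, ← Derivation.coeFnAddMonoidHom_apply, map_sum, Finset.sum_apply]
    refine Finset.sum_congr rfl fun j _ => ?_
    exact mul_comm _ _
  refine algebraicIndependent_of_dual_derivations h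
    (fun i => ∑ j, M.adjugate j i • MvPolynomial.pderiv j) (fun i k hki => ?_) (fun i => ?_)
  · rw [happly, Matrix.mul_adjugate, Matrix.smul_apply, Matrix.one_apply_ne hki, smul_zero]
  · rwa [happly, Matrix.mul_adjugate, Matrix.smul_apply, Matrix.one_apply_eq, smul_eq_mul, mul_one]

theorem mem_pointIdeal_iff {n : ℕ} {p : Fin n → ℂ} {f : PolyRing n} :
    f ∈ pointIdeal p ↔ MvPolynomial.eval p f = 0 := by
  have hle : ∀ g ∈ pointIdeal p, MvPolynomial.eval p g = 0 := by
    intro g hg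
    have : pointIdeal p ≤ RingHom.ker (MvPolynomial.eval p) := by
      rw [pointIdeal, Ideal.span_le]
      rintro _ ⟨j, rfl⟩
      simp [RingHom.mem_ker]
    exact this hg
  refine ⟨hle f, fun hf => ?_⟩
  have hsub : ∀ g : PolyRing n, g - MvPolynomial.C (MvPolynomial.eval p g) ∈ pointIdeal p := by
    intro g
    induction g using MvPolynomial.induction_on with
    | C a => simp
    | add g g' hg hg' =>
      rw [map_add, map_add, add_sub_add_comm]
      exact Ideal.add_mem _ hg hg'
    | mul_X g j hg =>
      have hj : MvPolynomial.X j - MvPolynomial.C (p j) ∈ pointIdeal p :=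
        Ideal.subset_span ⟨j, rfl⟩
      have := Ideal.add_mem _ (Ideal.mul_mem_right (MvPolynomial.X j) _ hg)
        (Ideal.mul_mem_left _ (MvPolynomial.C (MvPolynomial.eval p g)) hj)
      convert! this using 1
      simp only [map_mul, MvPolynomial.eval_X]
      ring
  simpa [hf] using hsub f

theorem pointIdeal_isMaximal {n : ℕ} (p : Fin n → ℂ) : (pointIdeal p).IsMaximal := by
  have : pointIdeal p = RingHom.ker (MvPolynomial.eval p) := by
    ext f
    rw [mem_pointIdeal_iff, RingHom.mem_ker]
  rw [this]
  exact RingHom.ker_isMaximal_of_surjective _ fun c => ⟨MvPolynomial.C c, MvPolynomial.eval_C c⟩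

theorem isMaximal_iff_exists_pointIdeal {n : ℕ} {M : Ideal (PolyRing n)} :
    M.IsMaximal ↔ ∃ p, M = pointIdeal p := by
  refine ⟨fun hM => ?_, fun ⟨p, hp⟩ => hp ▸ pointIdeal_isMaximal p⟩
  obtain ⟨p, hp⟩ := MvPolynomial.isMaximal_iff_eq_vanishingIdeal_singleton.mp hM
  refine ⟨p, ?_⟩
  ext f
  rw [hp, MvPolynomial.mem_vanishingIdeal_singleton_iff, mem_pointIdeal_iff,
    MvPolynomial.aeval_eq_eval]

variable {m : ℕ} {s t : Fin m → PolyRing (m + 2)}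

/-- Every polynomial is congruent to a constant modulo a maximal ideal, and constants have zero
brackets. -/
theorem isResiduallyNull_of_isPoissonMaximal {M : Ideal (PolyRing (m + 2))}
    (hM : IsPoissonMaximal (bracket s t) M) : IsResiduallyNull (bracket s t) M := by
  obtain ⟨p, rfl⟩ := isMaximal_iff_exists_pointIdeal.mp hM.1
  intro f g
  have := hM.2 (f - MvPolynomial.C (MvPolynomial.eval p f))
    (mem_pointIdeal_iff.mpr (by simp)) g
  rwa [bracket_sub_left, bracket_C_left, sub_zero] at this

theorem eval_pencilAt (p : Fin (m + 2) → ℂ) (i : Fin m) :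
    MvPolynomial.eval p (pencilAt s t p i) = 0 := by
  simp [pencilAt, pencil, mul_comm]

theorem eval_pderiv_pencilAt (p : Fin (m + 2) → ℂ) (i : Fin m) (j : Fin (m + 2)) :
    MvPolynomial.eval p (MvPolynomial.pderiv j (pencilAt s t p i)) =
      MvPolynomial.eval p (t i) * MvPolynomial.eval p (MvPolynomial.pderiv j (s i)) -
        MvPolynomial.eval p (s i) * MvPolynomial.eval p (MvPolynomial.pderiv j (t i)) := by
  simp [pencilAt, pencil]

/-- At the point `p`, the bracket is the Jacobian determinant with the polynomials `gᵢ`. -/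
theorem eval_bracket (p : Fin (m + 2) → ℂ) (f g : PolyRing (m + 2)) :
    MvPolynomial.eval p (bracket s t f g) = MvPolynomial.eval p
      (Matrix.of fun i j => MvPolynomial.pderiv j
        ((Matrix.vecCons f (Matrix.vecCons g (pencilAt s t p)) :
          Fin (m + 2) → PolyRing (m + 2)) i)).det := by
  rw [map_bracket, RingHom.map_det]
  congr 1
  ext k j
  refine Fin.cases ?_ (fun k => Fin.cases ?_ (fun i => ?_) k) k
  · simp
  · simp
  · simp [eval_pderiv_pencilAt]

theorem linearIndependent_row_iff_not_rank_lt {k n : ℕ} (M : Matrix (Fin k) (Fin n) ℂ) :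
    LinearIndependent ℂ M.row ↔ ¬ M.rank < k := by
  rw [linearIndependent_iff_card_le_finrank_span, Set.finrank, ← Matrix.rank_eq_finrank_span_row,
    Fintype.card_fin, not_lt]

/-- If the gradients of the `gᵢ` at `p` are linearly independent, they can be completed to a basis
by the gradients of two linear forms, whose bracket then does not vanish at `p`. -/
theorem isResiduallyNull_pointIdeal_iff (p : Fin (m + 2) → ℂ) :
    IsResiduallyNull (bracket s t) (pointIdeal p) ↔
      IsJacobianSingular (pencilAt s t p) p := by
  rw [IsJacobianSingular, and_iff_right (eval_pencilAt p)]
  set M : Matrix (Fin m) (Fin (m + 2)) ℂ := Matrix.of fun i j =>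
    MvPolynomial.eval p (MvPolynomial.pderiv j (pencilAt s t p i)) with hM
  have hbr : ∀ f g, MvPolynomial.eval p (bracket s t f g) =
      (Matrix.of (Matrix.vecCons (fun j => MvPolynomial.eval p (MvPolynomial.pderiv j f))
        (Matrix.vecCons (fun j => MvPolynomial.eval p (MvPolynomial.pderiv j g)) M.row))).det := by
    intro f g
    rw [map_bracket]
    congr 1
    ext k j
    refine Fin.cases ?_ (fun k => Fin.cases ?_ (fun i => ?_) k) k
    · simp
    · simp
    · exact (eval_pderiv_pencilAt p i j).symm
  constructor
  · contrapose
    rw [← linearIndependent_row_iff_not_rank_lt]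
    intro hli hnull
    obtain ⟨v, hv⟩ := exists_linearIndependent_cons_of_lt_finrank hli (by simp)
    obtain ⟨w, hw⟩ := exists_linearIndependent_cons_of_lt_finrank hv (by simp)
    have hgrad : ∀ v : Fin (m + 2) → ℂ, ∃ f : PolyRing (m + 2),
        (fun j => MvPolynomial.eval p (MvPolynomial.pderiv j f)) = v := by
      intro v
      refine ⟨∑ j, MvPolynomial.C (v j) * MvPolynomial.X j, ?_⟩
      ext j
      simp [MvPolynomial.pderiv_X, Pi.single_apply]
    obtain ⟨f, hf⟩ := hgrad w
    obtain ⟨g, hg⟩ := hgrad v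
    have h0 := mem_pointIdeal_iff.mp (hnull f g)
    rw [hbr, hf, hg] at h0
    have hunit := (Matrix.isUnit_iff_isUnit_det _).mp
      (Matrix.linearIndependent_rows_iff_isUnit (A := Matrix.of (Matrix.vecCons w
        (Matrix.vecCons v M.row))).mp hw)
    exact hunit.ne_zero h0
  · intro hrank f g
    rw [mem_pointIdeal_iff, hbr]
    by_contra hdet
    have hli := Matrix.linearIndependent_rows_iff_isUnit.mpr
      ((Matrix.isUnit_iff_isUnit_det _).mpr (isUnit_iff_ne_zero.mpr hdet))
    refine (linearIndependent_row_iff_not_rank_lt M).mp ?_ hrank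
    exact hli.comp (fun i : Fin m => i.succ.succ)
      ((Fin.succ_injective _).comp (Fin.succ_injective _))

theorem isPoissonMaximal_iff {P : Ideal (PolyRing (m + 2))} :
    IsPoissonMaximal (bracket s t) P ↔ ∃ p : Fin (m + 2) → ℂ, P = pointIdeal p ∧
      ((∃ i, MvPolynomial.eval p (s i) = 0 ∧ MvPolynomial.eval p (t i) = 0) ∨
        ¬ AlgebraicIndependent ℂ (pencilAt s t p) ∨
        IsJacobianSingular (pencilAt s t p) p) := by
  constructor
  · intro hP
    obtain ⟨p, rfl⟩ := isMaximal_iff_exists_pointIdeal.mp hP.1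
    exact ⟨p, rfl, Or.inr (Or.inr ((isResiduallyNull_pointIdeal_iff p).mp
      (isResiduallyNull_of_isPoissonMaximal hP)))⟩
  · rintro ⟨p, rfl, h⟩
    refine ⟨pointIdeal_isMaximal p, isPoissonIdeal_of_isResiduallyNull ?_⟩
    rcases h with ⟨i, hs, ht⟩ | h | h
    · intro f g
      rw [mem_pointIdeal_iff, map_bracket]
      exact Matrix.det_eq_zero_of_row_eq_zero i.succ.succ fun j => by simp [hs, ht]
    · intro f g
      rw [mem_pointIdeal_iff, eval_bracket]
      by_contra hne
      exact h ((algebraicIndependent_of_det_pderiv_ne_zero _ (ne_zero_of_map hne)).comp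
        (fun i : Fin m => i.succ.succ) ((Fin.succ_injective _).comp (Fin.succ_injective _)))
    · exact (isResiduallyNull_pointIdeal_iff p).mpr h

end Points

/-! ### Poisson primitive ideals -/

section Primitive

variable {m : ℕ} {s t : Fin m → PolyRing (m + 2)}

theorem exists_isMaximal_notMem {R : Type*} [CommRing R] [IsJacobsonRing R] {P : Ideal R}
    [hP : P.IsPrime] {a : R} (ha : a ∉ P) : ∃ M : Ideal R, M.IsMaximal ∧ P ≤ M ∧ a ∉ M := by
  by_contra! hcon
  refine ha ?_
  rw [← hP.radical, P.radical_eq_jacobson]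
  exact Submodule.mem_sInf.mpr fun M hM => hcon M hM.2 hM.1

theorem isPoissonPrimitive_of_isPoissonMaximal {P : Ideal (PolyRing (m + 2))}
    (hP : IsPoissonMaximal (bracket s t) P) : IsPoissonPrimitive (bracket s t) P :=
  ⟨hP.2, P, hP.1, le_antisymm (le_poissonCore hP.2 le_rfl)
    (poissonCore_le (bracket_isBiderivation s t) P)⟩

theorem isPoissonPrimitive_isPrime {P : Ideal (PolyRing (m + 2))}
    (hP : IsPoissonPrimitive (bracket s t) P) : P.IsPrime := by
  obtain ⟨_, M, hM, rfl⟩ := hP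
  have := hM.isPrime
  exact poissonCore_isPrime (k := ℂ) (bracket_isBiderivation s t) (bracket_algebraMap_left s t) M

/-- A maximal ideal that is not Poisson is the ideal of a point `p` at which no pair `sᵢ, tᵢ`
vanishes, and its Poisson core contains the polynomials `gᵢ = tᵢ(p) sᵢ - sᵢ(p) tᵢ`. -/
theorem IsPoissonPrimitive.isPoissonMaximal_or (ht : ∀ i, t i ≠ 0)
    (hst : ∀ i, IsRelPrime (s i) (t i)) {P : Ideal (PolyRing (m + 2))}
    (hP : IsPoissonPrimitive (bracket s t) P) :
    IsPoissonMaximal (bracket s t) P ∨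
      (¬ IsResiduallyNull (bracket s t) P ∧ ContainsPencil s t P) := by
  obtain ⟨hPois, M, hM, hPM⟩ := hP
  have hPM' : P ≤ M := hPM ▸ poissonCore_le (bracket_isBiderivation s t) M
  by_cases hMP : IsPoissonIdeal (bracket s t) M
  · left
    have : P = M := le_antisymm hPM' (hPM ▸ le_poissonCore hMP le_rfl)
    exact this ▸ ⟨hM, hMP⟩
  · right
    refine ⟨fun hnull => hMP (isPoissonIdeal_of_isResiduallyNull fun a b => hPM' (hnull a b)), ?_⟩
    obtain ⟨p, rfl⟩ := isMaximal_iff_exists_pointIdeal.mp hM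
    refine ⟨_, _, fun i hi => hMP ?_, hPM ▸ le_poissonCore (pencilIdeal_isPoisson ht hst
      (fun i => MvPolynomial.eval p (t i)) (fun i => MvPolynomial.eval p (s i))) ?_⟩
    · exact (isPoissonMaximal_iff.mpr ⟨p, rfl, Or.inl ⟨i, (Prod.ext_iff.mp hi).2,
        (Prod.ext_iff.mp hi).1⟩⟩).2
    · rw [pencilIdeal, Ideal.span_le]
      rintro _ ⟨i, rfl⟩
      exact mem_pointIdeal_iff.mpr (eval_pencilAt p i)

/-- If `{a, b} ∉ P`, then `P` is the Poisson core of any maximal ideal over `P` that does not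
contain `{a, b}`. -/
theorem isPoissonPrimitive_of_containsPencil {P : Ideal (PolyRing (m + 2))} [P.IsPrime]
    (hPois : IsPoissonIdeal (bracket s t) P) (hnull : ¬ IsResiduallyNull (bracket s t) P)
    (hP : ContainsPencil s t P) : IsPoissonPrimitive (bracket s t) P := by
  have hnull' := hnull
  simp only [IsResiduallyNull, not_forall] at hnull'
  obtain ⟨a, b, hab⟩ := hnull'
  obtain ⟨M, hM, hPM, habM⟩ := exists_isMaximal_notMem hab
  have hbi := bracket_isBiderivation s t
  have := hM.isPrime
  have : (poissonCore (bracket s t) M).IsPrime :=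
    poissonCore_isPrime (k := ℂ) hbi (bracket_algebraMap_left s t) M
  exact ⟨hPois, M, hM, eq_of_le_of_containsPencil (poissonCore_isPoisson hbi M)
    (fun h => habM (poissonCore_le hbi M (h a b))) hP (le_poissonCore hPois hPM)⟩

theorem isPoissonPrimitive_iff (ht : ∀ i, t i ≠ 0) (hst : ∀ i, IsRelPrime (s i) (t i))
    {P : Ideal (PolyRing (m + 2))} : IsPoissonPrimitive (bracket s t) P ↔
      IsPoissonMaximal (bracket s t) P ∨
      (IsPoissonIdeal (bracket s t) P ∧ ¬ IsResiduallyNull (bracket s t) P ∧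
        ∃ l u : Fin m → ℂ, (∀ i, (l i, u i) ≠ (0, 0)) ∧ pencilIdeal s t l u ≠ ⊤ ∧
          P ∈ (pencilIdeal s t l u).minimalPrimes) := by
  constructor
  · intro hP
    have hprime := isPoissonPrimitive_isPrime hP
    refine (hP.isPoissonMaximal_or ht hst).imp_right fun ⟨hnull, l, u, hlu, hle⟩ =>
      ⟨hP.1, hnull, l, u, hlu, ne_top_of_le_ne_top hprime.ne_top hle, ⟨hprime, hle⟩,
        fun Q hQ hQP => ?_⟩
    have := hQ.1
    exact (eq_of_le_of_containsPencil hP.1 hnull ⟨l, u, hlu, hQ.2⟩ hQP).ge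
  · rintro (hP | ⟨hPois, hnull, l, u, hlu, -, hmin⟩)
    · exact isPoissonPrimitive_of_isPoissonMaximal hP
    · have := hmin.1.1
      exact isPoissonPrimitive_of_containsPencil hPois hnull ⟨l, u, hlu, hmin.1.2⟩

end Primitive

/-! ### Locally closed points of the Poisson spectrum -/

section LocallyClosed

variable {R : Type*} [CommRing R] {br : R → R → R}

theorem mem_of_isOpen_of_le {U : Set (PoissonSpectrum br)} (hU : IsOpen U)
    {P Q : PoissonSpectrum br} (hPQ : P.1 ≤ Q.1) (hQ : Q ∈ U) : P ∈ U := by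
  induction hU with
  | basic U hU =>
    obtain ⟨I, rfl⟩ := hU
    exact fun hI => hQ (le_trans hI hPQ)
  | univ => trivial
  | inter U V _ _ ihU ihV => exact ⟨ihU hQ.1, ihV hQ.2⟩
  | sUnion S _ ih =>
    obtain ⟨U, hU, hQU⟩ := hQ
    exact ⟨U, hU, ih U hU hQU⟩

theorem exists_notMem_of_isOpen {U : Set (PoissonSpectrum br)} (hU : IsOpen U)
    {P : PoissonSpectrum br} [hP : P.1.IsPrime] (hPU : P ∈ U) :
    ∃ a ∉ P.1, ∀ Q : PoissonSpectrum br, a ∉ Q.1 → Q ∈ U := by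
  induction hU with
  | basic U hU =>
    obtain ⟨I, rfl⟩ := hU
    have hIP : ¬ I ≤ P.1 := hPU
    obtain ⟨a, haI, haP⟩ := SetLike.not_le_iff_exists.mp hIP
    exact ⟨a, haP, fun Q haQ hIQ => haQ (hIQ haI)⟩
  | univ => exact ⟨1, fun h => hP.ne_top ((Ideal.eq_top_iff_one _).mpr h), fun _ _ => trivial⟩
  | inter U V _ _ ihU ihV =>
    obtain ⟨a, haP, ha⟩ := ihU hPU.1
    obtain ⟨b, hbP, hb⟩ := ihV hPU.2
    exact ⟨a * b, fun h => (hP.mem_or_mem h).elim haP hbP, fun Q hQ =>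
      ⟨ha Q fun h => hQ (Q.1.mul_mem_right _ h), hb Q fun h => hQ (Q.1.mul_mem_left _ h)⟩⟩
  | sUnion S _ ih =>
    obtain ⟨U, hU, hPU⟩ := hPU
    obtain ⟨a, haP, ha⟩ := ih U hU hPU
    exact ⟨a, haP, fun Q hQ => ⟨U, hU, ha Q hQ⟩⟩

theorem isLocallyClosed_singleton_iff {P : PoissonSpectrum br} [P.1.IsPrime] :
    IsLocallyClosed ({P} : Set (PoissonSpectrum br)) ↔
      ∃ a ∉ P.1, ∀ Q : PoissonSpectrum br, P.1 ≤ Q.1 → a ∉ Q.1 → Q = P := by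
  constructor
  · rintro ⟨U, Z, hU, hZ, hUZ⟩
    have hP : P ∈ U ∩ Z := hUZ ▸ Set.mem_singleton P
    obtain ⟨a, haP, ha⟩ := exists_notMem_of_isOpen hU hP.1
    refine ⟨a, haP, fun Q hPQ haQ => ?_⟩
    have hQZ : Q ∈ Z := by
      by_contra hQ
      exact mem_of_isOpen_of_le hZ.isOpen_compl hPQ hQ hP.2
    exact (hUZ ▸ ⟨ha Q haQ, hQZ⟩ : Q ∈ ({P} : Set (PoissonSpectrum br)))
  · rintro ⟨a, haP, ha⟩
    refine ⟨{Q | Ideal.span {a} ≤ Q.1}ᶜ, {Q | P.1 ≤ Q.1},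
      TopologicalSpace.isOpen_generateFrom_of_mem ⟨_, rfl⟩,
      ⟨TopologicalSpace.isOpen_generateFrom_of_mem ⟨_, rfl⟩⟩, ?_⟩
    ext Q
    simp only [Set.mem_singleton_iff, Set.mem_inter_iff, Set.mem_compl_iff, Set.mem_ofPred_eq,
      Ideal.span_singleton_le_iff_mem]
    refine ⟨?_, fun h => ha Q h.2 h.1⟩
    rintro rfl
    exact ⟨haP, le_rfl⟩

end LocallyClosed

/-! ### The bracket on fraction fields -/

section FractionField

variable {R : Type*} [CommRing R] [IsDomain R] {br : R → R → R}

theorem fractionBracket_div (h : IsBiderivation br) {a b s t : R} (hs : s ≠ 0) (ht : t ≠ 0) :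
    fractionBracket br (algebraMap R (FractionRing R) a / algebraMap R _ s)
        (algebraMap R (FractionRing R) b / algebraMap R _ t) =
      algebraMap R _ (quotientRuleNum br a s b t) /
        (algebraMap R _ s ^ 2 * algebraMap R _ t ^ 2) := by
  have := fractionBracket_mk h a b ⟨s, mem_nonZeroDivisors_of_ne_zero hs⟩
    ⟨t, mem_nonZeroDivisors_of_ne_zero ht⟩
  rw [IsFractionRing.mk'_eq_div, IsFractionRing.mk'_eq_div, IsFractionRing.mk'_eq_div,
    Submonoid.coe_mul, SubmonoidClass.coe_pow, SubmonoidClass.coe_pow, map_mul, map_pow,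
    map_pow] at this
  exact this

theorem exists_algebraMap_div (z : FractionRing R) :
    ∃ a s : R, s ≠ 0 ∧ algebraMap R (FractionRing R) a / algebraMap R _ s = z := by
  obtain ⟨a, s, hs, h⟩ := IsFractionRing.div_surjective (A := R) z
  exact ⟨a, s, nonZeroDivisors.ne_zero hs, h⟩

theorem fractionBracket_anti (h : IsBiderivation br) (anti : ∀ a b, br a b = - br b a)
    (z w : FractionRing R) : fractionBracket br z w = - fractionBracket br w z := by
  obtain ⟨a, s, hs, rfl⟩ := exists_algebraMap_div z
  obtain ⟨b, t, ht, rfl⟩ := exists_algebraMap_div w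
  rw [fractionBracket_div h hs ht, fractionBracket_div h ht hs, ← neg_div, ← map_neg]
  congr 1
  · congr 1
    simp only [quotientRuleNum]
    rw [anti a b, anti a t, anti s b, anti s t]
    ring
  · exact mul_comm _ _

theorem fractionBracket_isBiderivation (h : IsBiderivation br)
    (anti : ∀ a b, br a b = - br b a) : IsBiderivation (fractionBracket br) := by
  have hne : ∀ {s : R}, s ≠ 0 → algebraMap R (FractionRing R) s ≠ 0 := fun hs => by
    rwa [Ne, FaithfulSMul.algebraMap_eq_zero_iff]
  have hadd : ∀ x y z, fractionBracket br (x + y) z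
      = fractionBracket br x z + fractionBracket br y z := by
    intro x y z
    obtain ⟨a, s, hs, rfl⟩ := exists_algebraMap_div x
    obtain ⟨b, t, ht, rfl⟩ := exists_algebraMap_div y
    obtain ⟨c, u, hu, rfl⟩ := exists_algebraMap_div z
    rw [div_add_div _ _ (hne hs) (hne ht), ← map_mul, ← map_mul, ← map_mul, ← map_add,
      fractionBracket_div h (mul_ne_zero hs ht) hu, fractionBracket_div h hs hu,
      fractionBracket_div h ht hu]
    have := hne hs
    have := hne ht
    have := hne hu
    simp only [quotientRuleNum, h.add_left, h.leibniz_left, map_add, map_sub, map_mul]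
    field_simp
    ring
  have hmul : ∀ x y z, fractionBracket br (x * y) z
      = x * fractionBracket br y z + y * fractionBracket br x z := by
    intro x y z
    obtain ⟨a, s, hs, rfl⟩ := exists_algebraMap_div x
    obtain ⟨b, t, ht, rfl⟩ := exists_algebraMap_div y
    obtain ⟨c, u, hu, rfl⟩ := exists_algebraMap_div z
    rw [div_mul_div_comm, ← map_mul, ← map_mul,
      fractionBracket_div h (mul_ne_zero hs ht) hu, fractionBracket_div h hs hu,
      fractionBracket_div h ht hu]
    have := hne hs
    have := hne ht
    have := hne hu
    simp only [quotientRuleNum, h.leibniz_left, map_add, map_sub, map_mul]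
    field_simp
    ring
  have hanti := fractionBracket_anti h anti
  refine ⟨hadd, fun a b c => ?_, hmul, fun a b c => ?_⟩
  · rw [hanti, hadd, hanti a b, hanti a c]; ring
  · rw [hanti, hmul, hanti a b, hanti a c]; ring

/-- The Poisson centre of an algebra whose bracket vanishes on `ℂ`. -/
def centerSubalgebra {K : Type*} [CommRing K] [Algebra ℂ K] {br : K → K → K}
    (h : IsBiderivation br) (hk : ∀ (c : ℂ) (z : K), br (algebraMap ℂ K c) z = 0) :
    Subalgebra ℂ K where
  carrier := poissonCenter br
  mul_mem' {a b} ha hb z := by rw [h.leibniz_left, ha z, hb z, mul_zero, mul_zero, add_zero]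
  add_mem' {a b} ha hb z := by rw [h.add_left, ha z, hb z, add_zero]
  algebraMap_mem' c z := hk c z

/-- On a field algebraic over `ℂ(a, b)` with `{a, b} ≠ 0`, the Poisson centre `Z` is `ℂ`: since `a`
and `b` are independent over `Z`, additivity of transcendence degrees makes `Z` algebraic
over `ℂ`. -/
theorem poissonCenter_eq_range {K : Type*} [Field K] [Algebra ℂ K] {br : K → K → K}
    (h : IsBiderivation br) (anti : ∀ a b, br a b = - br b a)
    (hk : ∀ (c : ℂ) (z : K), br (algebraMap ℂ K c) z = 0) {a b : K} (hab : br a b ≠ 0)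
    (halg : Algebra.IsAlgebraic (Algebra.adjoin ℂ (Set.range ![a, b])) K) :
    poissonCenter br = Set.range (algebraMap ℂ K) := by
  refine Set.Subset.antisymm ?_ (by rintro _ ⟨c, rfl⟩; exact hk c)
  set Z := centerSubalgebra h hk
  have : CharZero Z := charZero_of_injective_algebraMap (algebraMap ℂ Z).injective
  have : FaithfulSMul ℂ Z :=
    (faithfulSMul_iff_algebraMap_injective ℂ Z).mpr (algebraMap ℂ Z).injective
  have hind : AlgebraicIndependent Z ![a, b] :=
    algebraicIndependent_pair_of_bracket_ne_zero h anti (fun z w => z.2 w) hab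
  have hge : (2 : Cardinal) ≤ Algebra.trdeg Z K := by
    have := hind.lift_cardinalMk_le_trdeg
    simpa using this
  have hle : Algebra.trdeg ℂ K ≤ 2 := by
    refine (Algebra.IsAlgebraic.trdeg_le_cardinalMk ℂ (Set.range ![a, b])).trans ?_
    have := Cardinal.mk_range_le_lift (f := ![a, b])
    simpa using this
  have hsum := trdeg_add_eq ℂ Z (A := K)
  have hzero : Algebra.trdeg ℂ Z = 0 := by
    have h1 : Algebra.trdeg ℂ Z + 2 ≤ 0 + 2 := by
      rw [zero_add]
      exact (add_le_add_right hge _).trans (hsum.le.trans hle)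
    exact nonpos_iff_eq_zero.mp
      ((Cardinal.add_le_add_iff_of_lt_aleph0
        (by exact_mod_cast Cardinal.natCast_lt_aleph0 (n := 2))).mp h1)
  have hZalg : Algebra.IsAlgebraic ℂ Z := trdeg_eq_zero_iff.mp hzero
  intro z hz
  have hint : Algebra.IsIntegral ℂ Z := Algebra.isAlgebraic_iff_isIntegral.mp hZalg
  obtain ⟨c, hc⟩ := (IsAlgClosed.algebraMap_bijective_of_isIntegral (k := ℂ) (K := Z)).2 ⟨z, hz⟩
  exact ⟨c, congrArg Subtype.val hc⟩

end FractionField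

/-! ### Rational Poisson primes -/

section Rational

variable {m : ℕ} {s t : Fin m → PolyRing (m + 2)} {P : Ideal (PolyRing (m + 2))}

theorem quotientBracket_anti (hP : IsPoissonIdeal (bracket s t) P)
    (x y : PolyRing (m + 2) ⧸ P) :
    quotientBracket (bracket s t) P x y = - quotientBracket (bracket s t) P y x := by
  have hbi := bracket_isBiderivation s t
  have anti := bracket_anti s t
  obtain ⟨x, rfl⟩ := Ideal.Quotient.mk_surjective x
  obtain ⟨y, rfl⟩ := Ideal.Quotient.mk_surjective y
  rw [quotientBracket_mk hbi anti hP, quotientBracket_mk hbi anti hP, anti, map_neg]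

/-- The bracket of the quotient field of `A ⧸ P`, in terms of representatives in `A`. -/
theorem fractionBracket_residue_div [P.IsPrime] (hP : IsPoissonIdeal (bracket s t) P)
    {f g x y : PolyRing (m + 2)} (hy : residue P y ≠ 0) (hg : residue P g ≠ 0) :
    fractionBracket (quotientBracket (bracket s t) P) (residue P f / residue P g)
        (residue P x / residue P y) =
      residue P (quotientRuleNum (bracket s t) f g x y) /
        (residue P g ^ 2 * residue P y ^ 2) := by
  have hbi := bracket_isBiderivation s t
  have anti := bracket_anti s t
  have hne : ∀ {g}, residue P g ≠ 0 → Ideal.Quotient.mk P g ≠ 0 := fun hg h =>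
    hg (by rw [residue_apply, h, map_zero])
  have := fractionBracket_div (quotientBracket_isBiderivation hbi anti hP)
    (a := Ideal.Quotient.mk P f) (b := Ideal.Quotient.mk P x) (hne hg) (hne hy)
  simp only [quotientRuleNum, quotientBracket_mk hbi anti hP, ← map_mul, ← map_sub,
    ← map_add] at this
  exact this

theorem fractionBracket_residue [P.IsPrime] (hP : IsPoissonIdeal (bracket s t) P)
    (f x : PolyRing (m + 2)) :
    fractionBracket (quotientBracket (bracket s t) P) (residue P f) (residue P x) =
      residue P (bracket s t f x) := by
  have h1 : residue P 1 ≠ 0 := by rw [map_one]; exact one_ne_zero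
  have hx : ∀ g, bracket s t 1 g = 0 := fun g => by
    rw [← map_one MvPolynomial.C, bracket_C_left]
  have := fractionBracket_residue_div hP (f := f) (x := x) h1 h1
  simpa [quotientRuleNum, hx, bracket_anti s t f 1] using this

theorem fractionBracket_algebraMap [P.IsPrime] (hP : IsPoissonIdeal (bracket s t) P) (c : ℂ)
    (z : FractionRing (PolyRing (m + 2) ⧸ P)) :
    fractionBracket (quotientBracket (bracket s t) P) (algebraMap ℂ _ c) z = 0 := by
  obtain ⟨x, y, hy, rfl⟩ := exists_residue_div_residue P z
  have h1 : residue P 1 ≠ 0 := by rw [map_one]; exact one_ne_zero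
  have hx : ∀ g, bracket s t 1 g = 0 := fun g => by
    rw [← map_one MvPolynomial.C, bracket_C_left]
  have := fractionBracket_residue_div hP (f := algebraMap ℂ _ c) (x := x) hy h1
  rw [AlgHom.commutes, map_one, div_one] at this
  rw [this]
  simp [quotientRuleNum, hx, bracket_C_left]

theorem isPoissonRational_of_containsPencil [P.IsPrime] (hPois : IsPoissonIdeal (bracket s t) P)
    (hnull : ¬ IsResiduallyNull (bracket s t) P) (hP : ContainsPencil s t P) :
    IsPoissonRational (bracket s t) P := by
  simp only [IsResiduallyNull, not_forall] at hnull
  obtain ⟨a, b, hab⟩ := hnull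
  have hq := quotientBracket_isBiderivation (bracket_isBiderivation s t) (bracket_anti s t) hPois
  have hanti := quotientBracket_anti hPois
  refine poissonCenter_eq_range (fractionBracket_isBiderivation hq hanti)
    (fractionBracket_anti hq hanti) (fractionBracket_algebraMap hPois)
    (a := residue P a) (b := residue P b) ?_ (isAlgebraic_of_bracket_notMem hP hab)
  rwa [fractionBracket_residue hPois, Ne, residue_eq_zero_iff]

/-- The quotient field of `A ⧸ M` is `ℂ` for a maximal ideal `M`. -/
theorem isPoissonRational_of_isPoissonMaximal (hP : IsPoissonMaximal (bracket s t) P) :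
    IsPoissonRational (bracket s t) P := by
  have := hP.1.isPrime
  refine Set.Subset.antisymm (fun z _ => ?_) ?_
  · obtain ⟨p, rfl⟩ := isMaximal_iff_exists_pointIdeal.mp hP.1
    obtain ⟨x, y, hy, rfl⟩ := exists_residue_div_residue _ z
    have hconst : ∀ f, residue (pointIdeal p) f = algebraMap ℂ _ (MvPolynomial.eval p f) := by
      intro f
      rw [← AlgHom.commutes (residue (pointIdeal p)), ← sub_eq_zero, ← map_sub,
        residue_eq_zero_iff, mem_pointIdeal_iff]
      simp
    exact ⟨MvPolynomial.eval p x / MvPolynomial.eval p y, by rw [map_div₀, hconst, hconst]⟩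
  · rintro _ ⟨c, rfl⟩
    exact fractionBracket_algebraMap hP.2 c

/-- In the quotient field of `A ⧸ P`, each `sᵢ / tᵢ` is central, hence constant, unless `tᵢ ∈ P`. -/
theorem containsPencil_of_isPoissonRational [P.IsPrime]
    (hPois : IsPoissonIdeal (bracket s t) P) (hP : IsPoissonRational (bracket s t) P) :
    ContainsPencil s t P := by
  have hex : ∀ i, ∃ lu : ℂ × ℂ, lu ≠ (0, 0) ∧
      MvPolynomial.C lu.1 * s i - MvPolynomial.C lu.2 * t i ∈ P := by
    intro i
    by_cases hti : t i ∈ P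
    · exact ⟨(0, 1), by simp, by simpa using hti⟩
    · have hti' : residue P (t i) ≠ 0 := residue_eq_zero_iff.not.mpr hti
      have hcen : residue P (s i) / residue P (t i) ∈
          poissonCenter (fractionBracket (quotientBracket (bracket s t) P)) := by
        intro z
        obtain ⟨x, y, hy, rfl⟩ := exists_residue_div_residue P z
        rw [fractionBracket_residue_div hPois hy hti']
        have : quotientRuleNum (bracket s t) (s i) (t i) x y = 0 := by
          simp only [quotientRuleNum]
          linear_combination y * mul_bracket_eq_mul_bracket s t i x
            - x * mul_bracket_eq_mul_bracket s t i y
        rw [this, map_zero, zero_div]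
      rw [hP] at hcen
      obtain ⟨c, hc⟩ := hcen
      refine ⟨(1, c), by simp, ?_⟩
      rw [← residue_eq_zero_iff, map_sub, map_mul, map_mul, map_one, map_one, one_mul, sub_eq_zero,
        ← MvPolynomial.algebraMap_eq, AlgHom.commutes, hc, div_mul_cancel₀ _ hti']
  choose lu hlu hmem using hex
  refine ⟨fun i => (lu i).1, fun i => (lu i).2, hlu, ?_⟩
  rw [pencilIdeal, Ideal.span_le]
  rintro _ ⟨i, rfl⟩
  exact hmem i

/-- If the induced bracket is zero, everything is central, so rationality forces `A ⧸ P = ℂ`. -/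
theorem isPoissonMaximal_of_isPoissonRational [P.IsPrime]
    (hPois : IsPoissonIdeal (bracket s t) P) (hnull : IsResiduallyNull (bracket s t) P)
    (hP : IsPoissonRational (bracket s t) P) : IsPoissonMaximal (bracket s t) P := by
  refine ⟨?_, hPois⟩
  have hsurj : ∀ f, ∃ c : ℂ, f - MvPolynomial.C c ∈ P := by
    intro f
    have hcen : residue P f ∈
        poissonCenter (fractionBracket (quotientBracket (bracket s t) P)) := by
      intro z
      obtain ⟨x, y, hy, rfl⟩ := exists_residue_div_residue P z
      have h1 : residue P 1 ≠ 0 := by rw [map_one]; exact one_ne_zero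
      have := fractionBracket_residue_div hPois (f := f) (x := x) hy h1
      rw [map_one, div_one] at this
      have hbr : ∀ a b, residue P (bracket s t a b) = 0 := fun a b =>
        residue_eq_zero_iff.mpr (hnull a b)
      rw [this]
      simp [quotientRuleNum, hbr]
    rw [hP] at hcen
    obtain ⟨c, hc⟩ := hcen
    refine ⟨c, ?_⟩
    rw [← residue_eq_zero_iff, map_sub, ← MvPolynomial.algebraMap_eq, AlgHom.commutes, hc, sub_self]
  have hker : P = pointIdeal fun j => (hsurj (MvPolynomial.X j)).choose := by
    refine ((pointIdeal_isMaximal _).eq_of_le (Ideal.IsPrime.ne_top ‹_›) ?_).symm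
    rw [pointIdeal, Ideal.span_le]
    rintro _ ⟨j, rfl⟩
    exact (hsurj (MvPolynomial.X j)).choose_spec
  rw [hker]
  exact pointIdeal_isMaximal _

end Rational

/-! ### The Poisson Dixmier–Moeglin equivalence -/

theorem poissonDixmierMoeglin {m : ℕ} {s t : Fin m → PolyRing (m + 2)} (ht : ∀ i, t i ≠ 0)
    (hst : ∀ i, IsRelPrime (s i) (t i)) : PoissonDixmierMoeglin (bracket s t) := by
  intro P
  have hbi := bracket_isBiderivation s t
  have hPois := P.2.isPoisson
  have hprime : P.1.IsPrime := P.2.isPrime (k := ℂ) hbi (bracket_algebraMap_left s t)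
  tfae_have 1 → 2 := by
    rw [isLocallyClosed_singleton_iff]
    rintro ⟨a, haP, ha⟩
    obtain ⟨M, hM, hPM, haM⟩ := exists_isMaximal_notMem haP
    have := hM.isPrime
    have : (poissonCore (bracket s t) M).IsPrime :=
      poissonCore_isPrime (k := ℂ) hbi (bracket_algebraMap_left s t) M
    have hcore := ha ⟨poissonCore (bracket s t) M, (poissonCore_isPoisson hbi M).isPoissonPrime⟩
      (le_poissonCore hPois hPM) fun h => haM (poissonCore_le hbi M h)
    exact ⟨hPois, M, hM, (congrArg Subtype.val hcore).symm⟩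
  tfae_have 2 → 1 := by
    intro h
    rw [isLocallyClosed_singleton_iff]
    rcases h.isPoissonMaximal_or ht hst with hmax | ⟨hnull, hpen⟩
    · exact ⟨1, fun h => hprime.ne_top ((Ideal.eq_top_iff_one _).mpr h), fun Q hPQ _ =>
        Subtype.ext (hmax.1.eq_of_le Q.2.ne_top hPQ).symm⟩
    · have hnull' := hnull
      simp only [IsResiduallyNull, not_forall] at hnull'
      obtain ⟨a, b, hab⟩ := hnull'
      refine ⟨bracket s t a b, hab, fun Q hPQ habQ => Subtype.ext ?_⟩
      have : Q.1.IsPrime := Q.2.isPrime (k := ℂ) hbi (bracket_algebraMap_left s t)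
      exact (eq_of_le_of_containsPencil Q.2.isPoisson (fun h => habQ (h a b)) hpen hPQ).symm
  tfae_have 2 → 3 := fun h => (h.isPoissonMaximal_or ht hst).elim
    isPoissonRational_of_isPoissonMaximal
    fun h => isPoissonRational_of_containsPencil hPois h.1 h.2
  tfae_have 3 → 2 := by
    intro h
    by_cases hnull : IsResiduallyNull (bracket s t) P.1
    · exact isPoissonPrimitive_of_isPoissonMaximal
        (isPoissonMaximal_of_isPoissonRational hPois hnull h)
    · exact isPoissonPrimitive_of_containsPencil hPois hnull
        (containsPencil_of_isPoissonRational hPois h)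
  tfae_finish

end JacobianPoisson

open JacobianPoisson in
theorem theorem3p4 (m : ℕ) (hm : 1 ≤ m) (s t : Fin m → PolyRing (m + 2))
    (ht : ∀ i, t i ≠ 0) (hst : ∀ i, IsRelPrime (s i) (t i))
    (hind : AlgebraicIndependent ℂ fun i =>
      algebraMap (PolyRing (m + 2)) (RatField (m + 2)) (s i) /
        algebraMap (PolyRing (m + 2)) (RatField (m + 2)) (t i)) :
    (∀ P : Ideal (PolyRing (m + 2)), IsPoissonPrimitive (bracket s t) P ↔
      IsPoissonMaximal (bracket s t) P ∨
      (IsPoissonIdeal (bracket s t) P ∧ ¬ IsResiduallyNull (bracket s t) P ∧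
        ∃ l u : Fin m → ℂ, (∀ i, (l i, u i) ≠ (0, 0)) ∧ pencilIdeal s t l u ≠ ⊤ ∧
          P ∈ (pencilIdeal s t l u).minimalPrimes)) ∧
    (∀ P : Ideal (PolyRing (m + 2)), IsPoissonMaximal (bracket s t) P ↔
      ∃ p : Fin (m + 2) → ℂ, P = pointIdeal p ∧
        ((∃ i, MvPolynomial.eval p (s i) = 0 ∧ MvPolynomial.eval p (t i) = 0) ∨
          ¬ AlgebraicIndependent ℂ (pencilAt s t p) ∨
          IsJacobianSingular (pencilAt s t p) p)) ∧
    PoissonDixmierMoeglin (bracket s t) :=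
  ⟨fun _ => isPoissonPrimitive_iff ht hst, fun _ => isPoissonMaximal_iff,
    poissonDixmierMoeglin ht hst⟩
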